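/- All graphs are finite, undirected and simple. A clique of a graph $G=(V,E)$ is a set of vertices inducing a complete subgraph; an edge clique cover of $G$ is a set $\mathcal{C}$ of cliques of $G$ such that both ends of every edge of $G$ lie together in at least one clique of $\mathcal{C}$; an assignment-minimum clique cover of $G$ is an edge clique cover $\mathcal{C}$ for which the number of individual assignments $\sum_{C\in\mathcal{C}}|C|$ is minimum among all edge clique covers of $G$. There is an algorithm (a fixed program for the word RAM with words of $O(\log n)$ bits, unit cost per elementary operation, and space measured in words) that, given a graph $G$ with $n$ vertices and $m$ edges as $n$, $m$ and a list of the edges, computes an assignment-minimum clique cover of $G$ in $2^{O(m\log n)}$ time using $O(mn)$ space. (Logarithms are to base two; for $m=0$ the bounds are read as $O(1)$, and words as having $O(1+\log n)$ bits.) -/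

import Mathlib

/-! ### Word RAM with unit cost per instruction -/

namespace WordRAM

/-- The binary operations of the machine. -/
inductive Op where
  | add
  | sub
  | mul
  | div
  | lt

/-- The value of an operation on natural numbers (`sub` is truncated at `0`, division by `0` gives
`0`, a comparison gives `1` or `0`). -/
def Op.eval : Op → ℕ → ℕ → ℕ
  | .add, a, b => a + b
  | .sub, a, b => a - b
  | .mul, a, b => a * b
  | .div, a, b => a / b
  | .lt, a, b => if a < b then 1 else 0

/-- Right-hand sides: constants, registers, indirect reads from memory, and operations. -/
inductive Expr where
  | const (k : ℕ)
  | reg (r : ℕ)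
  | load (a : Expr)
  | op (o : Op) (a b : Expr)

/-- Programs in structured form. A program is a finite text, so it mentions finitely many registers;
there is no recursion and no allocation besides registers and the memory array. -/
inductive Prog where
  /-- do nothing -/
  | skip
  /-- `reg r := e` -/
  | assign (r : ℕ) (e : Expr)
  /-- `mem a := e` -/
  | store (a e : Expr)
  /-- first `p`, then `q` -/
  | seq (p q : Prog)
  /-- `p` if the value of `e` is nonzero, otherwise `q` -/
  | ite (e : Expr) (p q : Prog)
  /-- repeat `p` as long as the value of `e` is nonzero -/
  | loop (e : Expr) (p : Prog)

/-- The contents of the registers and of the memory. -/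
structure State where
  reg : ℕ → ℕ
  mem : ℕ → ℕ

/-- The state after writing `v` into register `r`. -/
def State.setReg (σ : State) (r v : ℕ) : State :=
  { σ with reg := Function.update σ.reg r v }

/-- The state after writing `v` into memory cell `a`. -/
def State.setMem (σ : State) (a v : ℕ) : State :=
  { σ with mem := Function.update σ.mem a v }

/-- The value of an expression. -/
def Expr.eval (σ : State) : Expr → ℕ
  | .const k => k
  | .reg r => σ.reg r
  | .load a => σ.mem (a.eval σ)
  | .op o a b => o.eval (a.eval σ) (b.eval σ)

/-- The number of elementary steps that the evaluation of an expression takes: one for each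
constant, register access, memory access and operation. -/
def Expr.cost : Expr → ℕ
  | .const _ => 1
  | .reg _ => 1
  | .load a => a.cost + 1
  | .op _ a b => a.cost + b.cost + 1

/-- The evaluation of an expression is legal on a machine with words of `w` bits and `S` memory
cells: no constant and no intermediate result exceeds a word, and only existing cells are read. -/
def Expr.Legal (w S : ℕ) (σ : State) : Expr → Prop
  | .const k => k < 2 ^ w
  | .reg _ => True
  | .load a => a.Legal w S σ ∧ a.eval σ < S
  | .op o a b => a.Legal w S σ ∧ b.Legal w S σ ∧ o.eval (a.eval σ) (b.eval σ) < 2 ^ w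

/-- `Exec w S p σ t τ`: on a machine with words of `w` bits and `S` memory cells, the program `p`
started in state `σ` halts in state `τ` after exactly `t` elementary steps. A run that would
overflow a word or access a cell outside of the memory is not a run (the machine is stuck). -/
inductive Exec (w S : ℕ) : Prog → State → ℕ → State → Prop where
  | skip (σ : State) : Exec w S .skip σ 1 σ
  | assign (σ : State) (r : ℕ) (e : Expr) (he : e.Legal w S σ) :
      Exec w S (.assign r e) σ (e.cost + 1) (σ.setReg r (e.eval σ))
  | store (σ : State) (a e : Expr) (ha : a.Legal w S σ) (he : e.Legal w S σ)
      (hS : a.eval σ < S) :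
      Exec w S (.store a e) σ (a.cost + e.cost + 1) (σ.setMem (a.eval σ) (e.eval σ))
  | seq {p q : Prog} {σ τ ρ : State} {t u : ℕ} (hp : Exec w S p σ t τ) (hq : Exec w S q τ u ρ) :
      Exec w S (.seq p q) σ (t + u) ρ
  | iteTrue {e : Expr} {p q : Prog} {σ τ : State} {t : ℕ} (he : e.Legal w S σ)
      (h : e.eval σ ≠ 0) (hp : Exec w S p σ t τ) :
      Exec w S (.ite e p q) σ (e.cost + 1 + t) τ
  | iteFalse {e : Expr} {p q : Prog} {σ τ : State} {t : ℕ} (he : e.Legal w S σ)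
      (h : e.eval σ = 0) (hq : Exec w S q σ t τ) :
      Exec w S (.ite e p q) σ (e.cost + 1 + t) τ
  | loopDone {e : Expr} {p : Prog} {σ : State} (he : e.Legal w S σ) (h : e.eval σ = 0) :
      Exec w S (.loop e p) σ (e.cost + 1) σ
  | loopStep {e : Expr} {p : Prog} {σ τ ρ : State} {t u : ℕ} (he : e.Legal w S σ)
      (h : e.eval σ ≠ 0) (hp : Exec w S p σ t τ) (hl : Exec w S (.loop e p) τ u ρ) :
      Exec w S (.loop e p) σ (e.cost + 1 + t + u) ρ

/-- The initial state on input `x`: the input occupies the first cells of the memory, all other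
cells and all registers are `0`. -/
def initState (x : List ℕ) : State where
  reg _ := 0
  mem i := x.getD i 0

/-- On a machine with words of `w` bits and a memory of `S` cells (which has to hold the input, all
working storage, and the output), the program `p` on input `x` halts after exactly `t` elementary
steps with output `y`. The output is a contiguous block of memory, and register `0` holds the
address of its first cell. -/
def Computes (w S : ℕ) (p : Prog) (x : List ℕ) (t : ℕ) (y : List ℕ) : Prop :=
  x.length ≤ S ∧ (∀ v ∈ x, v < 2 ^ w) ∧
    ∃ τ : State, Exec w S p (initState x) t τ ∧ τ.reg 0 + y.length ≤ S ∧
      ∀ (i : ℕ) (hi : i < y.length), τ.mem (τ.reg 0 + i) = y[i]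

end WordRAM

/-! ### Clique covers -/

namespace CliqueCover

/-- A set of cliques such that every edge is contained in at least one of them. -/
def IsEdgeCliqueCover {V : Type*} (G : SimpleGraph V) (𝒞 : Finset (Finset V)) : Prop :=
  (∀ C ∈ 𝒞, G.IsClique (C : Set V)) ∧ ∀ x y : V, G.Adj x y → ∃ C ∈ 𝒞, x ∈ C ∧ y ∈ C

/-- The number of individual assignments of vertices to cliques. -/
def assignments {V : Type*} (𝒞 : Finset (Finset V)) : ℕ := ∑ C ∈ 𝒞, C.card

/-- An edge clique cover with the minimum number of individual assignments. -/
def IsAssignmentMinimum {V : Type*} (G : SimpleGraph V) (𝒞 : Finset (Finset V)) : Prop :=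
  IsEdgeCliqueCover G 𝒞 ∧
    ∀ 𝒟 : Finset (Finset V), IsEdgeCliqueCover G 𝒟 → assignments 𝒞 ≤ assignments 𝒟

/-- `es` lists every edge of `G` exactly once, in any order and with any order of the two ends. -/
def IsEdgeList {n : ℕ} (G : SimpleGraph (Fin n)) (es : List (Fin n × Fin n)) : Prop :=
  (es.map fun e => s(e.1, e.2)).Nodup ∧
    ∀ e : Sym2 (Fin n), e ∈ (es.map fun e => s(e.1, e.2)) ↔ e ∈ G.edgeSet

/-- The input words: the number of vertices, the number of edges, and the ends of the edges. -/
def encodeGraph {n : ℕ} (es : List (Fin n × Fin n)) : List ℕ :=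
  n :: es.length :: es.flatMap fun e => [(e.1 : ℕ), (e.2 : ℕ)]

/-- `cs` lists every clique of `𝒞` exactly once, in any order, each as a list of its vertices
without repetition, in any order. -/
def IsCoverList {n : ℕ} (𝒞 : Finset (Finset (Fin n))) (cs : List (List (Fin n))) : Prop :=
  (∀ c ∈ cs, c.Nodup) ∧ (cs.map List.toFinset).Nodup ∧ (cs.map List.toFinset).toFinset = 𝒞

/-- The output words: the number of cliques, and for each clique its size and its vertices. -/
def encodeCover {n : ℕ} (cs : List (List (Fin n))) : List ℕ :=
  cs.length :: cs.flatMap fun c => c.length :: c.map fun v => (v : ℕ)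

end CliqueCover

/-! The algorithm is exhaustive search over labelings of the edges by numbers below `m`. Sending
every edge to one clique of a given cover that contains it, and naming each used clique by the index
of one of its edges, turns the cover into a labeling of no larger cost (`exists_labeling`).
Conversely, a labeling is proper when the ends of equally labeled edges form cliques, and these
cliques cover all edges. At minimum cost distinct labels have distinct classes, so the cost is
exactly the number of assignments (`labelCover_isAssignmentMinimum`).

The search runs through the natural numbers `N`. The `m` low digits of `N` in base `m` are the
labels, and the quotient `N / m ^ m` is a guessed cost, the target. A number is accepted when its
labeling is proper and costs exactly the target. Because the target is the most significant part,
the first accepted number has the least possible cost (`exists_first_goal`). The labeling that gives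
each edge its own label is proper and costs at most `2 * m`, so fewer than `(2 * m + 1) * m ^ m`
numbers come before success. Each test takes polynomial time and `m ≤ n ^ 2`, whence `2 ^ O(m log
n)`. Only the input, `m` labels, the target and the output are stored, which is `O(m)` cells.

The test and the output are arithmetic terms with bounded sums. One compiler theorem,
`Tm.compile_runs`, bounds time and all intermediate values of such a term by a fixed power of a
common bound `A`, so only value, memory safety and scope have to be checked for each term.
Incrementing `N` is a carry propagation (`carry_runs`). -/

/-! ### Reasoning about runs -/

namespace WordRAM

/-- The program halts within `T` steps in a state satisfying `Q`. -/
def Runs (w S : ℕ) (p : Prog) (σ : State) (T : ℕ) (Q : State → Prop) : Prop :=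
  ∃ t τ, Exec w S p σ t τ ∧ t ≤ T ∧ Q τ

namespace Runs

variable {w S : ℕ} {p q : Prog} {σ : State} {T U : ℕ} {Q R : State → Prop}

theorem mono (h : Runs w S p σ T Q) (hT : T ≤ U) (hQ : ∀ τ, Q τ → R τ) : Runs w S p σ U R := by
  obtain ⟨t, τ, he, ht, hq⟩ := h
  exact ⟨t, τ, he, ht.trans hT, hQ τ hq⟩

theorem le (h : Runs w S p σ T Q) (hT : T ≤ U) : Runs w S p σ U Q := h.mono hT fun _ h => h

theorem skip (h : Q σ) : Runs w S .skip σ 1 Q := ⟨1, σ, .skip σ, le_rfl, h⟩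

theorem assign {r : ℕ} {e : Expr} (he : e.Legal w S σ) (h : Q (σ.setReg r (e.eval σ))) :
    Runs w S (.assign r e) σ (e.cost + 1) Q :=
  ⟨_, _, .assign σ r e he, le_rfl, h⟩

theorem store {a e : Expr} (ha : a.Legal w S σ) (he : e.Legal w S σ) (hS : a.eval σ < S)
    (h : Q (σ.setMem (a.eval σ) (e.eval σ))) : Runs w S (.store a e) σ (a.cost + e.cost + 1) Q :=
  ⟨_, _, .store σ a e ha he hS, le_rfl, h⟩

theorem seq (hp : Runs w S p σ T R) (hq : ∀ τ, R τ → Runs w S q τ U Q) :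
    Runs w S (.seq p q) σ (T + U) Q := by
  obtain ⟨t, τ, he, ht, hr⟩ := hp
  obtain ⟨u, ρ, hf, hu, hQ⟩ := hq τ hr
  exact ⟨t + u, ρ, .seq he hf, by omega, hQ⟩

theorem iteTrue {e : Expr} (he : e.Legal w S σ) (h : e.eval σ ≠ 0) (hp : Runs w S p σ T Q) :
    Runs w S (.ite e p q) σ (e.cost + 1 + T) Q := by
  obtain ⟨t, τ, hx, ht, hr⟩ := hp
  exact ⟨_, τ, .iteTrue he h hx, by omega, hr⟩

theorem iteFalse {e : Expr} (he : e.Legal w S σ) (h : e.eval σ = 0) (hq : Runs w S q σ T Q) :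
    Runs w S (.ite e p q) σ (e.cost + 1 + T) Q := by
  obtain ⟨t, τ, hx, ht, hr⟩ := hq
  exact ⟨_, τ, .iteFalse he h hx, by omega, hr⟩

/-- A loop with invariant `I k` before round `k` that is left after `N` rounds. -/
theorem loop {e : Expr} (I : ℕ → State → Prop) (N : ℕ)
    (hstep : ∀ k < N, ∀ τ, I k τ → e.Legal w S τ ∧ e.eval τ ≠ 0 ∧ Runs w S p τ T (I (k + 1)))
    (hend : ∀ τ, I N τ → e.Legal w S τ ∧ e.eval τ = 0) (h0 : I 0 σ) :
    Runs w S (.loop e p) σ (N * (e.cost + 1 + T) + (e.cost + 1)) (I N) := by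
  -- The induction is on the number `d` of rounds still to come, since `loopStep` peels off the
  -- first round.
  have key : ∀ d k, k + d = N → ∀ τ, I k τ →
      Runs w S (.loop e p) τ (d * (e.cost + 1 + T) + (e.cost + 1)) (I N) := by
    intro d
    induction d with
    | zero =>
      intro k hk τ hτ
      obtain rfl : k = N := hk
      exact ⟨_, τ, .loopDone (hend τ hτ).1 (hend τ hτ).2, by omega, hτ⟩
    | succ d ih =>
      intro k hk τ hτ
      obtain ⟨hl, hne, t, ρ, hx, ht, hρ⟩ := hstep k (by omega) τ hτ
      obtain ⟨u, ξ, hy, hu, hξ⟩ := ih (k + 1) (by omega) ρ hρ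
      refine ⟨_, ξ, .loopStep hl hne hx hy, ?_, hξ⟩
      rw [Nat.succ_mul]
      omega
  exact key N 0 (by omega) σ h0

end Runs

@[simp] theorem State.setReg_mem (σ : State) (r v : ℕ) : (σ.setReg r v).mem = σ.mem := rfl

@[simp] theorem State.setMem_reg (σ : State) (a v : ℕ) : (σ.setMem a v).reg = σ.reg := rfl

@[simp] theorem State.setReg_reg (σ : State) (r v s : ℕ) :
    (σ.setReg r v).reg s = if s = r then v else σ.reg s := by
  simp [State.setReg, Function.update_apply]

@[simp] theorem State.setMem_mem (σ : State) (a v b : ℕ) :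
    (σ.setMem a v).mem b = if b = a then v else σ.mem b := by
  simp [State.setMem, Function.update_apply]

/-! ### Expressions with bounded sums -/

/-- Arithmetic terms with bounded summation. -/
inductive Tm where
  | const (k : ℕ)
  | var (r : ℕ)
  | load (a : Tm)
  | op (o : Op) (a b : Tm)
  /-- the sum of the values of `b` with the variable `x` running through the numbers below `N` -/
  | sum (x : ℕ) (N b : Tm)

namespace Tm

/-- The value of a term for memory contents `M` and values `ρ` of the variables. -/
def eval (M : ℕ → ℕ) : Tm → (ℕ → ℕ) → ℕ
  | const k, _ => k
  | var r, ρ => ρ r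
  | load a, ρ => M (a.eval M ρ)
  | op o a b, ρ => o.eval (a.eval M ρ) (b.eval M ρ)
  | sum x N b, ρ => ∑ j ∈ Finset.range (N.eval M ρ), b.eval M (Function.update ρ x j)

/-- All variables are below `d`. -/
def Scoped (d : ℕ) : Tm → Prop
  | const _ => True
  | var r => r < d
  | load a => a.Scoped d
  | op _ a b => a.Scoped d ∧ b.Scoped d
  | sum x N b => x < d ∧ N.Scoped d ∧ b.Scoped d

/-- Only the first `S` memory cells are read, and the variables and the limits of the sums do not
exceed `A`. -/
def Safe (S A : ℕ) (M : ℕ → ℕ) : Tm → (ℕ → ℕ) → Prop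
  | const _, _ => True
  | var r, ρ => ρ r ≤ A
  | load a, ρ => a.Safe S A M ρ ∧ a.eval M ρ < S
  | op _ a b, ρ => a.Safe S A M ρ ∧ b.Safe S A M ρ
  | sum x N b, ρ => N.Safe S A M ρ ∧ N.eval M ρ ≤ A ∧
      ∀ j < N.eval M ρ, b.Safe S A M (Function.update ρ x j)

/-- An exponent that bounds values and evaluation times. -/
def wt : Tm → ℕ
  | const k => k + 1
  | var _ => 1
  | load a => a.wt + 1
  | op _ a b => a.wt + b.wt + 1
  | sum _ N b => N.wt + b.wt + 2

/-- A program that writes the value of a term into register `d`, without changing memory or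
registers below `d`. -/
def compile : Tm → ℕ → Prog
  | const k, d => .assign d (.const k)
  | var r, d => .assign d (.reg r)
  | load a, d => .seq (a.compile d) (.assign d (.load (.reg d)))
  | op o a b, d => .seq (a.compile d) (.seq (b.compile (d + 1))
      (.assign d (.op o (.reg d) (.reg (d + 1)))))
  | sum x N b, d => .seq (N.compile d) (.seq (.assign (d + 1) (.const 0))
      (.seq (.assign (d + 2) (.reg x)) (.seq (.assign x (.const 0))
      (.seq (.loop (.op .lt (.reg x) (.reg d)) (.seq (b.compile (d + 3))
        (.seq (.assign (d + 1) (.op .add (.reg (d + 1)) (.reg (d + 3))))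
          (.assign x (.op .add (.reg x) (.const 1))))))
      (.seq (.assign x (.reg (d + 2))) (.assign d (.reg (d + 1))))))))

theorem Scoped.mono {d e : ℕ} (h : d ≤ e) {t : Tm} : t.Scoped d → t.Scoped e := by
  induction t with
  | const k => exact id
  | var r => exact fun hr => lt_of_lt_of_le hr h
  | load a ih => exact ih
  | op o a b iha ihb => exact fun hs => ⟨iha hs.1, ihb hs.2⟩
  | sum x N b ihN ihb => exact fun hs => ⟨lt_of_lt_of_le hs.1 h, ihN hs.2.1, ihb hs.2.2⟩

/-- A bound variable also lies below `d`, so agreement below `d` survives its update. This lets a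
subterm be evaluated after registers from `d` upward have been overwritten. -/
theorem eval_congr {d : ℕ} (M : ℕ → ℕ) (t : Tm) : t.Scoped d → ∀ {ρ ρ' : ℕ → ℕ},
    (∀ r < d, ρ r = ρ' r) → t.eval M ρ = t.eval M ρ' := by
  induction t with
  | const k => intros; rfl
  | var r => intro h ρ ρ' e; exact e r h
  | load a ih => intro h ρ ρ' e; simp only [eval, ih h e]
  | op o a b iha ihb => intro h ρ ρ' e; simp only [eval, iha h.1 e, ihb h.2 e]
  | sum x N b ihN ihb =>
    intro h ρ ρ' e
    simp only [eval, ihN h.2.1 e]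
    refine Finset.sum_congr rfl fun j _ => ihb h.2.2 fun r hr => ?_
    simp only [Function.update_apply, e r hr]

theorem safe_congr {d S A : ℕ} (M : ℕ → ℕ) (t : Tm) : t.Scoped d → ∀ {ρ ρ' : ℕ → ℕ},
    (∀ r < d, ρ r = ρ' r) → t.Safe S A M ρ → t.Safe S A M ρ' := by
  induction t with
  | const k => intros; trivial
  | var r => intro h ρ ρ' e hs; simpa only [Safe, e r h] using hs
  | load a ih => intro h ρ ρ' e hs; exact ⟨ih h e hs.1, eval_congr M a h e ▸ hs.2⟩
  | op o a b iha ihb => intro h ρ ρ' e hs; exact ⟨iha h.1 e hs.1, ihb h.2 e hs.2⟩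
  | sum x N b ihN ihb =>
    intro h ρ ρ' e hs
    have hN := eval_congr M N h.2.1 e
    refine ⟨ihN h.2.1 e hs.1, hN ▸ hs.2.1, fun j hj => ?_⟩
    refine ihb h.2.2 (fun r hr => ?_) (hs.2.2 j (hN ▸ hj))
    simp only [Function.update_apply, e r hr]

/-- Multiplication uses up `i + j`; the extra factor `A` absorbs the sum of two powers and the
comparison bit. -/
theorem _root_.WordRAM.Op.eval_le (o : Op) {A a b i j : ℕ} (hA : 16 ≤ A) (ha : a ≤ A ^ i)
    (hb : b ≤ A ^ j) : o.eval a b ≤ A ^ (i + j + 1) := by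
  have h1 : 1 ≤ A ^ i := Nat.one_le_pow _ _ (by omega)
  have h2 : 1 ≤ A ^ j := Nat.one_le_pow _ _ (by omega)
  have h3 : A ^ (i + j + 1) = A ^ i * A ^ j * A := by ring
  have h4 : A ^ i ≤ A ^ i * A ^ j := Nat.le_mul_of_pos_right _ h2
  have h5 : A ^ j ≤ A ^ i * A ^ j := Nat.le_mul_of_pos_left _ h1
  have h6 : A ^ i * A ^ j * 16 ≤ A ^ i * A ^ j * A := Nat.mul_le_mul_left _ hA
  rw [h3]
  cases o with
  | add => simp only [Op.eval]; omega
  | sub => simp only [Op.eval]; omega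
  | mul => simp only [Op.eval]; have := Nat.mul_le_mul ha hb; omega
  | div => simp only [Op.eval]; have := Nat.div_le_self a b; omega
  | lt => simp only [Op.eval]; split_ifs <;> omega

theorem eval_le {S A : ℕ} {M : ℕ → ℕ} (hA : 16 ≤ A) (hM : ∀ a < S, M a ≤ A) (t : Tm) :
    ∀ {ρ : ℕ → ℕ}, t.Safe S A M ρ → t.eval M ρ ≤ A ^ t.wt := by
  have hle : ∀ i, A ≤ A ^ (i + 1) := fun i => Nat.le_self_pow (by omega) A
  induction t with
  | const k =>
    intro ρ _
    exact (Nat.lt_pow_self (by omega)).le.trans (Nat.pow_le_pow_right (by omega) (Nat.le_succ k))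
  | var r => intro ρ h; exact le_trans h (hle 0)
  | load a ih => intro ρ h; exact (hM _ h.2).trans (hle _)
  | op o a b iha ihb => intro ρ h; exact o.eval_le hA (iha h.1) (ihb h.2)
  | sum x N b ihN ihb =>
    intro ρ h
    calc ∑ j ∈ Finset.range (N.eval M ρ), b.eval M (Function.update ρ x j)
        ≤ ∑ j ∈ Finset.range (N.eval M ρ), A ^ b.wt :=
          Finset.sum_le_sum fun j hj => ihb (h.2.2 j (Finset.mem_range.1 hj))
      _ = N.eval M ρ * A ^ b.wt := by simp
      _ ≤ A * A ^ b.wt := Nat.mul_le_mul_right _ h.2.1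
      _ = A ^ (b.wt + 1) := by ring
      _ ≤ A ^ (N.wt + b.wt + 2) := Nat.pow_le_pow_right (by omega) (by omega)

/-- The code keeps temporaries at `d` and above, and a subterm is compiled at a base beyond the
temporaries that are still needed. Only the bound variable of a sum is changed below `d`, and its
old value is put back. The power `A ^ t.wt` bounds the value, which excludes overflow, and also the
time. -/
theorem compile_runs {w S A : ℕ} (hA : 16 ≤ A) (t : Tm) :
    ∀ (d : ℕ) (σ : State), (∀ a < S, σ.mem a ≤ A) → A ^ t.wt < 2 ^ w → t.Scoped d →
      t.Safe S A σ.mem σ.reg →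
      Runs w S (t.compile d) σ (A ^ t.wt) fun τ => τ.mem = σ.mem ∧
        τ.reg d = t.eval σ.mem σ.reg ∧ ∀ r < d, τ.reg r = σ.reg r := by
  have hle : ∀ i, A ≤ A ^ (i + 1) := fun i => Nat.le_self_pow (by omega) A
  have hpos : ∀ i, 1 ≤ A ^ i := fun i => Nat.one_le_pow _ _ (by omega)
  have hwt : ∀ {i j}, i ≤ j → A ^ j < 2 ^ w → A ^ i < 2 ^ w := fun hij h =>
    lt_of_le_of_lt (Nat.pow_le_pow_right (by omega) hij) h
  induction t with
  | const k =>
    intro d σ hM hw hs hsafe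
    have := hle k
    refine Runs.le (T := 2) (Runs.assign (e := .const k)
      (lt_of_le_of_lt (eval_le hA hM (const k) hsafe) hw) ⟨rfl, ?_, ?_⟩) (by simp only [wt]; omega)
    · simp [eval, Expr.eval]
    · intro r hr; simp [hr.ne]
  | var s =>
    intro d σ hM hw hs hsafe
    refine Runs.le (T := 2) (Runs.assign (e := .reg s) trivial ⟨rfl, ?_, ?_⟩)
      (by simp only [wt, pow_one]; omega)
    · simp [eval, Expr.eval]
    · intro r hr; simp [hr.ne]
  | load a ih =>
    intro d σ hM hw hs hsafe
    have h1 := hpos a.wt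
    have h2 : A ^ a.wt * 16 ≤ A ^ a.wt * A := Nat.mul_le_mul_left _ hA
    refine Runs.le (Runs.seq (ih d σ hM (hwt (Nat.le_succ _) hw) hs hsafe.1)
      (U := 3) ?_) ?_
    · rintro τ ⟨hm, hv, hr⟩
      refine Runs.assign ⟨trivial, ?_⟩ ⟨hm, ?_, ?_⟩
      · simpa [Expr.eval, hv] using hsafe.2
      · simp [Expr.eval, eval, hv, hm]
      · intro r hlt; simp [hlt.ne, hr r hlt]
    · simp only [wt, pow_succ]; omega
  | op o a b iha ihb =>
    intro d σ hM hw hs hsafe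
    have h1 := hpos a.wt
    have h2 := hpos b.wt
    have h4 : A ^ a.wt ≤ A ^ a.wt * A ^ b.wt := Nat.le_mul_of_pos_right _ h2
    have h5 : A ^ b.wt ≤ A ^ a.wt * A ^ b.wt := Nat.le_mul_of_pos_left _ h1
    have h6 : A ^ a.wt * A ^ b.wt * 16 ≤ A ^ a.wt * A ^ b.wt * A := Nat.mul_le_mul_left _ hA
    refine Runs.le (Runs.seq (iha d σ hM (hwt (by simp only [wt]; omega) hw) hs.1 hsafe.1)
      (U := A ^ b.wt + 4) ?_) ?_
    · rintro τ ⟨hm, hv, hr⟩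
      have hsb := safe_congr σ.mem b hs.2 (fun r h => (hr r h).symm) hsafe.2
      have hmb : b.Scoped (d + 1) := Scoped.mono (Nat.le_succ d) hs.2
      refine Runs.seq (ihb (d + 1) τ (hm ▸ hM) (hwt (by simp only [wt]; omega) hw) hmb
        (hm.symm ▸ hsb)) ?_
      rintro υ ⟨hm', hv', hr'⟩
      have e1 : υ.reg d = a.eval σ.mem σ.reg := (hr' d (Nat.lt_succ_self d)).trans hv
      have e2 : υ.reg (d + 1) = b.eval σ.mem σ.reg := by
        rw [hv', hm]
        exact eval_congr σ.mem b hs.2 hr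
      refine Runs.assign ⟨trivial, trivial, ?_⟩ ⟨hm'.trans hm, ?_, ?_⟩
      · simp only [Expr.eval, e1, e2]
        exact lt_of_le_of_lt (eval_le hA hM (op o a b) hsafe) hw
      · simp [Expr.eval, eval, e1, e2]
      · intro r hlt
        simp [hlt.ne, hr' r (by omega), hr r hlt]
    · have h3 : A ^ (a.wt + b.wt + 1) = A ^ a.wt * A ^ b.wt * A := by ring
      simp only [wt, h3]; omega
  | sum x N b ihN ihb =>
    intro d σ hM hw hs hsafe
    obtain ⟨hx, hsN, hsb⟩ := hs
    obtain ⟨hsafeN, hNA, hsafeb⟩ := hsafe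
    have hAw : A < 2 ^ w := lt_of_le_of_lt (hle 0) (hwt (by simp only [wt]; omega) hw)
    have hw1 : 1 < 2 ^ w := by omega
    -- Partial sums are dominated by the full sum, so the accumulator never overflows.
    have hsum : ∀ k ≤ N.eval σ.mem σ.reg,
        ∑ j ∈ Finset.range k, b.eval σ.mem (Function.update σ.reg x j) < 2 ^ w := fun k hk =>
      lt_of_le_of_lt ((Finset.sum_le_sum_of_subset (Finset.range_subset_range.2 hk)).trans
        (eval_le hA hM (sum x N b) ⟨hsafeN, hNA, hsafeb⟩)) hw
    -- Register `d` holds the limit, `d + 1` the partial sum, `d + 2` the saved value of `x`, and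
    -- `x` itself is the counter; hence `x` is exempt from the agreement with `σ`.
    have hloop := fun υ => Runs.loop (w := w) (S := S) (σ := υ)
      (e := .op .lt (.reg x) (.reg d)) (T := A ^ b.wt + 8)
      (p := .seq (b.compile (d + 3)) (.seq (.assign (d + 1) (.op .add (.reg (d + 1)) (.reg (d + 3))))
          (.assign x (.op .add (.reg x) (.const 1)))))
      (fun k τ => τ.mem = σ.mem ∧ τ.reg d = N.eval σ.mem σ.reg ∧
        τ.reg (d + 1) = ∑ j ∈ Finset.range k, b.eval σ.mem (Function.update σ.reg x j) ∧
        τ.reg (d + 2) = σ.reg x ∧ τ.reg x = k ∧ ∀ r < d, r ≠ x → τ.reg r = σ.reg r)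
      (N.eval σ.mem σ.reg) ?_ ?_
    · refine Runs.le (Runs.seq (ihN d σ hM (hwt (by simp only [wt]; omega) hw) hsN hsafeN)
        (U := 2 + (2 + (2 + ((N.eval σ.mem σ.reg * (3 + 1 + (A ^ b.wt + 8)) + (3 + 1)) + (2 + 2))))) ?_) ?_
      · rintro τ ⟨hm, hv, hr⟩
        refine Runs.seq (Runs.assign (by simp only [Expr.Legal]; omega) rfl) ?_
        rintro _ rfl
        refine Runs.seq (Runs.assign trivial rfl) ?_
        rintro _ rfl
        refine Runs.seq (Runs.assign (by simp only [Expr.Legal]; omega) rfl) ?_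
        rintro _ rfl
        refine Runs.seq (hloop _ ?_) ?_
        · have e1 : d ≠ x := by omega
          have e2 : d + 1 ≠ x := by omega
          have e3 : d + 2 ≠ x := by omega
          have e4 : x ≠ d + 1 := by omega
          have e5 : x ≠ d + 2 := by omega
          refine ⟨hm, ?_, ?_, ?_, ?_, ?_⟩
          · simp [e1, hv]
          · simp [e2, Expr.eval]
          · simp [e3, e4, Expr.eval, hr x hx]
          · simp [Expr.eval]
          · intro r h1 h2
            have e6 : r ≠ d + 1 := by omega
            have e7 : r ≠ d + 2 := by omega
            simp [h2, e6, e7, hr r h1]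
        · rintro υ ⟨k1, k2, k3, k4, k5, k6⟩
          have e1 : d ≠ x := by omega
          have e2 : d + 1 ≠ x := by omega
          refine Runs.seq (Runs.assign trivial rfl) ?_
          rintro _ rfl
          refine Runs.assign trivial ⟨k1, ?_, ?_⟩
          · simp [Expr.eval, e2, k3, eval]
          · intro r h1
            by_cases h2 : r = x
            · subst h2; simp [h1.ne, Expr.eval, k4]
            · simp [h1.ne, h2, k6 r h1 h2]
      · have h1 := hpos N.wt
        have h2 := hpos b.wt
        have h4 : A ^ N.wt ≤ A ^ N.wt * A ^ b.wt := Nat.le_mul_of_pos_right _ h2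
        have h5 : A ^ b.wt ≤ A ^ N.wt * A ^ b.wt := Nat.le_mul_of_pos_left _ h1
        -- A round costs at most `13 * A ^ b.wt`. The summand `2` in the weight of a sum supplies
        -- two factors `A`, for the number of rounds and for the constants.
        have h6 : N.eval σ.mem σ.reg * (3 + 1 + (A ^ b.wt + 8)) ≤ A * (13 * A ^ b.wt) :=
          Nat.mul_le_mul hNA (by omega)
        have h7 : A * (13 * A ^ b.wt) ≤ A * (13 * (A ^ N.wt * A ^ b.wt)) :=
          Nat.mul_le_mul_left _ (Nat.mul_le_mul_left _ h5)
        have h8 : A ^ (N.wt + b.wt + 2) = A * A * (A ^ N.wt * A ^ b.wt) := by ring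
        simp only [wt, h8]
        generalize A ^ N.wt * A ^ b.wt = P at *
        nlinarith [Nat.mul_le_mul_right P (Nat.mul_le_mul hA hA),
          Nat.mul_le_mul_right P (Nat.mul_le_mul_right A hA), Nat.mul_le_mul_right P hA]
    · rintro k hk τ ⟨k1, k2, k3, k4, k5, k6⟩
      refine ⟨⟨trivial, trivial, ?_⟩, ?_, ?_⟩
      · simp only [Op.eval]; split_ifs <;> omega
      · simp [Expr.eval, Op.eval, k5, k2, hk]
      -- In round `k` the actual registers below `d` are the environment in which the summand has to
      -- be evaluated.
      · have hagree : ∀ r < d, Function.update σ.reg x k r = τ.reg r := by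
          intro r h1
          by_cases h2 : r = x
          · subst h2; simp [k5]
          · simp [h2, k6 r h1 h2]
        refine Runs.seq (ihb (d + 3) τ (k1 ▸ hM) (hwt (by simp only [wt]; omega) hw)
          (Scoped.mono (by omega) hsb) ?_) (U := 4 + 4) ?_
        · rw [k1]; exact safe_congr _ b hsb hagree (hsafeb k hk)
        · rintro υ ⟨l1, l2, l3⟩
          have e2 : x ≠ d + 1 := by omega
          have e2' : d + 1 ≠ x := by omega
          have e3 : d ≠ x := by omega
          have e4 : d + 2 ≠ x := by omega
          have m1 : υ.reg (d + 1) + υ.reg (d + 3) =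
              ∑ j ∈ Finset.range (k + 1), b.eval σ.mem (Function.update σ.reg x j) := by
            rw [Finset.sum_range_succ, l3 _ (by omega), k3, l2, k1, eval_congr _ b hsb hagree]
          have m2 := l3 x (by omega)
          refine Runs.seq (Runs.assign ⟨trivial, trivial, ?_⟩ rfl) ?_
          · simp only [Expr.eval, Op.eval, m1]
            exact hsum _ hk
          rintro _ rfl
          refine Runs.assign ⟨trivial, ?_, ?_⟩ ⟨?_, ?_, ?_, ?_, ?_, ?_⟩
          · simp only [Expr.Legal]; omega
          · simp [Expr.eval, Op.eval, e2, m2, k5]; omega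
          · exact l1.trans k1
          · simp [e3, l3, k2]
          · simp [e2', Expr.eval, Op.eval, m1]
          · simp [e4, l3, k4]
          · simp [Expr.eval, Op.eval, e2, m2, k5]
          · intro r h1 h2
            have e6 : r ≠ d + 1 := by omega
            simp [h2, e6, l3 r (by omega), k6 r h1 h2]
    · rintro τ ⟨k1, k2, k3, k4, k5, k6⟩
      refine ⟨⟨trivial, trivial, ?_⟩, ?_⟩
      · simp only [Op.eval]; split_ifs <;> omega
      · simp [Expr.eval, Op.eval, k5, k2]

end Tm

end WordRAM

/-! ### Clique covers from labelings of the edges -/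

namespace CliqueCover

open Finset

variable {V : Type*} [DecidableEq V]

/-- The edges of `G` are the pairs `v (2 * k), v (2 * k + 1)` with `k < m`. -/
def HasEnds (G : SimpleGraph V) (m : ℕ) (v : ℕ → V) : Prop :=
  ∀ x y, G.Adj x y ↔
    ∃ k < m, (v (2 * k) = x ∧ v (2 * k + 1) = y) ∨ (v (2 * k) = y ∧ v (2 * k + 1) = x)

/-- The ends of the edges with label `i`. -/
def labelClass (m : ℕ) (v : ℕ → V) (lab : ℕ → ℕ) (i : ℕ) : Finset V :=
  ((range (2 * m)).filter fun j => lab (j / 2) = i).image v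

/-- The ends of the edges with the same label form a clique. -/
def IsProper (G : SimpleGraph V) (m : ℕ) (v : ℕ → V) (lab : ℕ → ℕ) : Prop :=
  ∀ j < 2 * m, ∀ j' < 2 * m, lab (j / 2) = lab (j' / 2) → v j = v j' ∨ G.Adj (v j) (v j')

/-- The number of pairs of a label and an end of an edge with that label. -/
def labelCost (m : ℕ) (v : ℕ → V) (lab : ℕ → ℕ) : ℕ :=
  ((range (2 * m)).image fun j => (lab (j / 2), v j)).card

/-- The cliques of a labeling. -/
def labelCover (m : ℕ) (v : ℕ → V) (lab : ℕ → ℕ) : Finset (Finset V) :=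
  ((range m).image lab).image (labelClass m v lab)

variable {G : SimpleGraph V} {m : ℕ} {v : ℕ → V} {lab : ℕ → ℕ}

theorem labelCover_isEdgeCliqueCover (hG : HasEnds G m v) (h : IsProper G m v lab) :
    IsEdgeCliqueCover G (labelCover m v lab) := by
  constructor
  · intro C hC
    obtain ⟨i, _, rfl⟩ := mem_image.1 hC
    intro x hx y hy hxy
    simp only [labelClass, coe_image, Set.mem_image, coe_filter, mem_range,
      Set.mem_ofPred_eq] at hx hy
    obtain ⟨j, ⟨hj, rfl⟩, rfl⟩ := hx
    obtain ⟨j', ⟨hj', he⟩, rfl⟩ := hy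
    exact (h j hj j' hj' he.symm).resolve_left hxy
  · intro x y hxy
    obtain ⟨k, hk, hkxy⟩ := (hG x y).1 hxy
    have h0 : v (2 * k) ∈ labelClass m v lab (lab k) :=
      mem_image_of_mem v (mem_filter.2 ⟨mem_range.2 (by omega), by congr 1; omega⟩)
    have h1 : v (2 * k + 1) ∈ labelClass m v lab (lab k) :=
      mem_image_of_mem v (mem_filter.2 ⟨mem_range.2 (by omega), by congr 1; omega⟩)
    refine ⟨_, mem_image_of_mem _ (mem_image_of_mem _ (mem_range.2 hk)), ?_⟩
    rcases hkxy with ⟨rfl, rfl⟩ | ⟨rfl, rfl⟩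
    exacts [⟨h0, h1⟩, ⟨h1, h0⟩]

/-- Splits the pairs by label. The sum runs over labels rather than over cliques, so it can exceed
the assignments of `labelCover` when two labels have the same class. -/
theorem labelCost_eq_sum :
    labelCost m v lab = ∑ i ∈ (range m).image lab, (labelClass m v lab i).card := by
  rw [labelCost, card_eq_sum_card_fiberwise (f := Prod.fst) (t := (range m).image lab)]
  · refine sum_congr rfl fun i _ => ?_
    rw [← card_image_of_injective (labelClass m v lab i) (Prod.mk_right_injective i)]
    congr 1
    ext ⟨a, x⟩
    simp only [labelClass, mem_filter, mem_image, mem_range, Prod.mk.injEq]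
    constructor
    · rintro ⟨⟨j, hj, rfl, rfl⟩, rfl⟩
      exact ⟨_, ⟨j, ⟨hj, rfl⟩, rfl⟩, rfl, rfl⟩
    · rintro ⟨_, ⟨j, ⟨hj, rfl⟩, rfl⟩, rfl, rfl⟩
      exact ⟨⟨j, hj, rfl, rfl⟩, rfl⟩
  · intro p hp
    obtain ⟨j, hj, rfl⟩ := mem_image.1 hp
    exact mem_image_of_mem _ (mem_range.2 (by have := mem_range.1 hj; omega))

theorem labelCost_le : labelCost m v lab ≤ 2 * m :=
  card_image_le.trans (card_range _).le

theorem labelClass_nonempty {i : ℕ} (hi : i ∈ (range m).image lab) :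
    (labelClass m v lab i).Nonempty := by
  obtain ⟨k, hk, rfl⟩ := mem_image.1 hi
  have := mem_range.1 hk
  exact ⟨v (2 * k),
    mem_image_of_mem v (mem_filter.2 ⟨mem_range.2 (by omega), by congr 1; omega⟩)⟩

/-- Assigning each edge to a clique that covers it gives a labeling of at most the same cost. -/
theorem exists_labeling (hG : HasEnds G m v) {𝒟 : Finset (Finset V)}
    (h : IsEdgeCliqueCover G 𝒟) :
    ∃ lab : ℕ → ℕ, (∀ e < m, lab e < m) ∧ IsProper G m v lab ∧
      labelCost m v lab ≤ assignments 𝒟 := by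
  classical
  have hex : ∀ e, ∃ C : Finset V, e < m → C ∈ 𝒟 ∧ v (2 * e) ∈ C ∧ v (2 * e + 1) ∈ C := by
    intro e
    by_cases he : e < m
    · obtain ⟨C, hC⟩ := h.2 _ _ ((hG _ _).2 ⟨e, he, .inl ⟨rfl, rfl⟩⟩)
      exact ⟨C, fun _ => hC⟩
    · exact ⟨∅, fun h => absurd h he⟩
  choose g hg using hex
  -- A used clique is named by some edge assigned to it. This makes labels smaller than `m`, and `g`
  -- recovers the clique from its name.
  let rep : Finset V → ℕ := fun C => if hC : ∃ e < m, g e = C then hC.choose else 0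
  have hrep : ∀ e < m, rep (g e) < m ∧ g (rep (g e)) = g e := by
    intro e he
    have hC : ∃ e' < m, g e' = g e := ⟨e, he, rfl⟩
    simp only [rep, dif_pos hC]
    exact hC.choose_spec
  have hmem : ∀ j < 2 * m, g (j / 2) ∈ 𝒟 ∧ v j ∈ g (j / 2) := by
    intro j hj
    obtain ⟨h1, h2, h3⟩ := hg (j / 2) (by omega)
    refine ⟨h1, ?_⟩
    rcases Nat.mod_two_eq_zero_or_one j with h | h
    · rwa [show 2 * (j / 2) = j by omega] at h2
    · rwa [show 2 * (j / 2) + 1 = j by omega] at h3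
  refine ⟨fun e => rep (g e), fun e he => (hrep e he).1, ?_, ?_⟩
  · intro j hj j' hj' he
    have hgg : g (j / 2) = g (j' / 2) := by
      rw [← (hrep (j / 2) (by omega)).2, ← (hrep (j' / 2) (by omega)).2]
      exact congrArg g he
    by_cases hv : v j = v j'
    · exact .inl hv
    · exact .inr (h.1 _ (hmem j hj).1 (hmem j hj).2 (hgg ▸ (hmem j' hj').2) hv)
  · rw [assignments, ← card_sigma 𝒟 fun C => C, labelCost]
    -- A pair of label and vertex goes to the incidence of that vertex with the clique named by the
    -- label; recovering the name by `rep` gives injectivity.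
    refine card_le_card_of_injOn (fun p => ⟨g p.1, p.2⟩) ?_ ?_
    · intro p hp
      obtain ⟨j, hj, rfl⟩ := mem_image.1 hp
      have hj := mem_range.1 hj
      simp only [coe_sigma, Set.mem_sigma_iff, mem_coe, (hrep (j / 2) (by omega)).2]
      exact hmem j hj
    · intro p hp q hq hpq
      obtain ⟨j, hj, rfl⟩ := mem_image.1 hp
      obtain ⟨j', hj', rfl⟩ := mem_image.1 hq
      have hj := mem_range.1 hj
      have hj' := mem_range.1 hj'
      simp only [Sigma.mk.injEq, heq_eq_eq, (hrep (j / 2) (by omega)).2,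
        (hrep (j' / 2) (by omega)).2] at hpq
      simp only [hpq.1, hpq.2]

omit [DecidableEq V] in
-- Two different positions with the same label are the two ends of one edge. This labeling
-- guarantees that the search succeeds.
theorem isProper_id (hG : HasEnds G m v) : IsProper G m v id := by
  intro j hj j' hj' he
  by_cases h : j = j'
  · exact .inl (by rw [h])
  · refine .inr ((hG _ _).2 ⟨j / 2, by omega, ?_⟩)
    simp only [id] at he
    rcases Nat.mod_two_eq_zero_or_one j with h0 | h0
    · exact .inl ⟨by congr 1; omega, by congr 1; omega⟩
    · exact .inr ⟨by congr 1; omega, by congr 1; omega⟩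

/-- A proper labeling of minimum cost gives an assignment-minimum cover, by distinct cliques. -/
theorem labelCover_isAssignmentMinimum (hG : HasEnds G m v) (h : IsProper G m v lab)
    (hmin : ∀ lab' : ℕ → ℕ, (∀ e < m, lab' e < m) → IsProper G m v lab' →
      labelCost m v lab ≤ labelCost m v lab') :
    IsAssignmentMinimum G (labelCover m v lab) ∧
      Set.InjOn (labelClass m v lab) ((range m).image lab : Finset ℕ) := by
  have hcov := labelCover_isEdgeCliqueCover hG h
  have hle : ∀ 𝒟, IsEdgeCliqueCover G 𝒟 → labelCost m v lab ≤ assignments 𝒟 := by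
    intro 𝒟 h𝒟
    obtain ⟨lab', h1, h2, h3⟩ := exists_labeling hG h𝒟
    exact (hmin lab' h1 h2).trans h3
  have hinj : Set.InjOn (labelClass m v lab) ((range m).image lab : Finset ℕ) := by
    intro i hi i' hi' he
    by_contra hne
    -- If two labels had the same class, dropping one would leave the cover unchanged while its
    -- assignments number at most the cost minus the positive size of that class, contradicting
    -- `hle`.
    have hsub : labelCover m v lab =
        (((range m).image lab).erase i').image (labelClass m v lab) := by
      refine Subset.antisymm ?_ (image_subset_image (erase_subset _ _))
      intro C hC
      obtain ⟨a, ha, rfl⟩ := mem_image.1 hC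
      by_cases hai : a = i'
      · subst hai
        exact he ▸ mem_image_of_mem _ (mem_erase.2 ⟨hne, hi⟩)
      · exact mem_image_of_mem _ (mem_erase.2 ⟨hai, ha⟩)
    have h1 := hle _ hcov
    have h2 : assignments (labelCover m v lab) ≤
        ∑ i ∈ ((range m).image lab).erase i', (labelClass m v lab i).card := by
      rw [hsub, assignments]
      exact sum_image_le_of_nonneg (fun _ _ => Nat.zero_le _)
    have h3 := add_sum_erase _ (fun i => (labelClass m v lab i).card) (mem_coe.1 hi')
    have h4 := (labelClass_nonempty (v := v) (mem_coe.1 hi')).card_pos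
    rw [labelCost_eq_sum] at h1
    omega
  refine ⟨⟨hcov, fun 𝒟 h𝒟 => le_trans (le_of_eq ?_) (hle 𝒟 h𝒟)⟩, hinj⟩
  rw [assignments, labelCover, sum_image hinj, labelCost_eq_sum]

/-- Counting the first occurrences of the values of a function. -/
theorem card_filter_first {α : Type*} [DecidableEq α] (f : ℕ → α) (N : ℕ) :
    ((range N).filter fun j => ∀ j' < j, f j' ≠ f j).card = ((range N).image f).card := by
  induction N with
  | zero => simp
  | succ N ih =>
    rw [range_add_one, filter_insert, image_insert]
    by_cases h : ∀ j' < N, f j' ≠ f N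
    · rw [if_pos h, card_insert_of_notMem (by simp), card_insert_of_notMem, ih]
      simpa using h
    · rw [if_neg h, ih, insert_eq_of_mem]
      push Not at h
      simpa using h

/-- Position `j` is the first one with its label and its vertex. -/
def IsFirst (v : ℕ → V) (lab : ℕ → ℕ) (j : ℕ) : Prop :=
  ∀ j' < j, ¬(lab (j' / 2) = lab (j / 2) ∧ v j' = v j)

instance (v : ℕ → V) (lab : ℕ → ℕ) : DecidablePred (IsFirst v lab) :=
  fun _ => Nat.decidableBallLT _ _

theorem card_filter_isFirst :
    ((range (2 * m)).filter (IsFirst v lab)).card = labelCost m v lab := by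
  rw [labelCost, ← card_filter_first]
  congr 1
  refine filter_congr fun j _ => ?_
  simp [IsFirst]

/-- The positions that list the vertices of the clique with label `i`. -/
def classPositions (m : ℕ) (v : ℕ → V) (lab : ℕ → ℕ) (i : ℕ) : List ℕ :=
  (List.range (2 * m)).filter fun j => lab (j / 2) = i ∧ IsFirst v lab j

/-- The cliques of a labeling as lists of vertices. -/
def coverLists (m : ℕ) (v : ℕ → V) (lab : ℕ → ℕ) : List (List V) :=
  ((List.range m).filter fun i => ∃ j < 2 * m, lab (j / 2) = i).map fun i =>
    (classPositions m v lab i).map v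

theorem nodup_classPositions_map (i : ℕ) : ((classPositions m v lab i).map v).Nodup := by
  refine List.Nodup.map_on ?_ (List.nodup_range.filter _)
  intro j hj j' hj' he
  simp only [classPositions, List.mem_filter, decide_eq_true_eq] at hj hj'
  rcases lt_trichotomy j j' with h | h | h
  · exact absurd ⟨hj.2.1.trans hj'.2.1.symm, he⟩ (hj'.2.2 j h)
  · exact h
  · exact absurd ⟨hj'.2.1.trans hj.2.1.symm, he.symm⟩ (hj.2.2 j' h)

theorem toFinset_classPositions_map (i : ℕ) :
    ((classPositions m v lab i).map v).toFinset = labelClass m v lab i := by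
  classical
  ext x
  simp only [classPositions, labelClass, List.mem_toFinset, List.mem_map, List.mem_filter,
    List.mem_range, decide_eq_true_eq, mem_image, mem_filter, mem_range]
  constructor
  · rintro ⟨j, ⟨hj, h1, _⟩, rfl⟩
    exact ⟨j, ⟨hj, h1⟩, rfl⟩
  · rintro ⟨j, ⟨hj, rfl⟩, rfl⟩
    -- The least position with this label and vertex is a first occurrence.
    have hex : ∃ k, lab (k / 2) = lab (j / 2) ∧ v k = v j := ⟨j, rfl, rfl⟩
    refine ⟨Nat.find hex, ⟨lt_of_le_of_lt (Nat.find_min' hex ⟨rfl, rfl⟩) hj,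
      (Nat.find_spec hex).1, ?_⟩, (Nat.find_spec hex).2⟩
    intro k hk hkk
    rw [(Nat.find_spec hex).1, (Nat.find_spec hex).2] at hkk
    exact Nat.find_min hex hk hkk

theorem usedLabels_toFinset (hlab : ∀ e < m, lab e < m) :
    ((List.range m).filter fun i => ∃ j < 2 * m, lab (j / 2) = i).toFinset =
      (range m).image lab := by
  ext i
  simp only [List.mem_toFinset, List.mem_filter, List.mem_range, decide_eq_true_eq, mem_image,
    mem_range]
  constructor
  · rintro ⟨_, j, hj, rfl⟩
    exact ⟨j / 2, by omega, rfl⟩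
  · rintro ⟨e, he, rfl⟩
    exact ⟨hlab e he, 2 * e, by omega, by congr 1; omega⟩

theorem coverLists_map_toFinset (lab : ℕ → ℕ) : (coverLists m v lab).map List.toFinset =
    ((List.range m).filter fun i => ∃ j < 2 * m, lab (j / 2) = i).map (labelClass m v lab) := by
  rw [coverLists, List.map_map]
  exact List.map_congr_left fun i _ => toFinset_classPositions_map i

theorem length_coverLists_le : (coverLists m v lab).length ≤ m := by
  rw [coverLists, List.length_map]
  exact (List.length_filter_le _ _).trans (List.length_range).le

/-- The bound on the labels is needed because `coverLists` only visits labels below `m`. -/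
theorem sum_length_coverLists (hlab : ∀ e < m, lab e < m) :
    ((coverLists m v lab).map List.length).sum = labelCost m v lab := by
  rw [labelCost_eq_sum, ← usedLabels_toFinset hlab,
    List.sum_toFinset _ (List.nodup_range.filter _), coverLists, List.map_map]
  congr 1
  refine List.map_congr_left fun i _ => ?_
  rw [Function.comp_apply, ← List.toFinset_card_of_nodup (nodup_classPositions_map i),
    toFinset_classPositions_map]

end CliqueCover

/-! ### The terms of the algorithm -/

namespace CliqueCover

open WordRAM Finset

/-- The memory holds `m`, the ends of the edges, their labels and the target `c`. -/
structure Holds (M : ℕ → ℕ) (m : ℕ) (u lab : ℕ → ℕ) (c : ℕ) : Prop where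
  one : M 1 = m
  ends : ∀ j < 2 * m, M (2 + j) = u j
  label : ∀ e < m, M (2 + 2 * m + e) = lab e
  target : M (2 + 3 * m) = c

/-- `1` if the values are equal, otherwise `0`. -/
def eqT (a b : Tm) : Tm := .op .sub (.const 1) (.op .add (.op .lt a b) (.op .lt b a))

/-- `1` if the value is `0`, otherwise `0`. -/
def notT (a : Tm) : Tm := .op .lt a (.const 1)

/-- The product. -/
def mulT (a b : Tm) : Tm := .op .mul a b

/-- The sum. -/
def addT (a b : Tm) : Tm := .op .add a b

/-- The number of edges. -/
def edgesT : Tm := .load (.const 1)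

/-- The number of ends of edges. -/
def endsT : Tm := mulT (.const 2) edgesT

/-- The end in position `j`. -/
def endT (j : Tm) : Tm := .load (addT (.const 2) j)

/-- The label of the edge to which position `j` belongs. -/
def labelT (j : Tm) : Tm := .load (addT (addT (.const 2) endsT) (.op .div j (.const 2)))

/-- The target. -/
def targetT : Tm := .load (addT (.const 2) (mulT (.const 3) edgesT))

/-- The number of edges between the ends in the positions in registers `3` and `4`. -/
def adjT : Tm := .sum 5 edgesT (addT
  (mulT (eqT (endT (mulT (.const 2) (.var 5))) (endT (.var 3)))
    (eqT (endT (addT (mulT (.const 2) (.var 5)) (.const 1))) (endT (.var 4))))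
  (mulT (eqT (endT (mulT (.const 2) (.var 5))) (endT (.var 4)))
    (eqT (endT (addT (mulT (.const 2) (.var 5)) (.const 1))) (endT (.var 3)))))

/-- The number of pairs of positions that violate properness. -/
def badT : Tm := .sum 3 endsT (.sum 4 endsT (mulT (eqT (labelT (.var 3)) (labelT (.var 4)))
  (mulT (notT (eqT (endT (.var 3)) (endT (.var 4)))) (notT adjT))))

/-- The number of earlier positions with the same label and vertex. -/
def dupT (p : Tm) : Tm := .sum 4 p (mulT (eqT (labelT (.var 4)) (labelT p))
  (eqT (endT (.var 4)) (endT p)))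

/-- The cost. -/
def costT : Tm := .sum 3 endsT (notT (dupT (.var 3)))

/-- Zero if the labeling is proper and its cost is the target. -/
def invalidT : Tm := addT badT (notT (eqT costT targetT))

/-- The number of positions with label `i`. -/
def usedT (i : Tm) : Tm := .sum 3 endsT (eqT (labelT (.var 3)) i)

/-- The number of vertices of the clique with label `i`. -/
def sizeT (i : Tm) : Tm := .sum 3 endsT (mulT (eqT (labelT (.var 3)) i) (notT (dupT (.var 3))))

/-- The number of cliques. -/
def countT : Tm := .sum 2 edgesT (notT (notT (usedT (.var 2))))

/-- The number of output items per label. -/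
def itemsT : Tm := addT endsT (.const 1)

/-- The label of the output item `x`. -/
def itemLabelT : Tm := .op .div (.var 2) itemsT

/-- The position of the output item `x` within its label, or `0` for the size. -/
def itemPosT : Tm := .op .sub (.var 2) (mulT itemLabelT itemsT)

/-- The end to which the output item `x` belongs. -/
def itemEndT : Tm := .op .sub itemPosT (.const 1)

/-- Nonzero if the output item `x` is present. -/
def condT : Tm := addT (mulT (notT itemPosT) (usedT itemLabelT))
  (mulT (notT (notT itemPosT)) (mulT (eqT (labelT itemEndT) itemLabelT) (notT (dupT itemEndT))))

/-- The value of the output item `x`. -/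
def valT : Tm := addT (mulT (notT itemPosT) (sizeT itemLabelT))
  (mulT (notT (notT itemPosT)) (endT itemEndT))

/-! ### Values of the terms -/

section Eval

variable (M : ℕ → ℕ) (ρ : ℕ → ℕ)

@[simp] theorem eval_const (k : ℕ) : (Tm.const k).eval M ρ = k := rfl

@[simp] theorem eval_var (r : ℕ) : (Tm.var r).eval M ρ = ρ r := rfl

@[simp] theorem eval_mulT (a b : Tm) : (mulT a b).eval M ρ = a.eval M ρ * b.eval M ρ := rfl

@[simp] theorem eval_addT (a b : Tm) : (addT a b).eval M ρ = a.eval M ρ + b.eval M ρ := rfl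

@[simp] theorem eval_eqT (a b : Tm) :
    (eqT a b).eval M ρ = if a.eval M ρ = b.eval M ρ then 1 else 0 := by
  simp only [eqT, Tm.eval, Op.eval]
  split_ifs <;> omega

@[simp] theorem eval_notT (a : Tm) : (notT a).eval M ρ = if a.eval M ρ = 0 then 1 else 0 := by
  simp only [notT, Tm.eval, Op.eval, Nat.lt_one_iff]

variable {M ρ} {m : ℕ} {u lab : ℕ → ℕ} {c : ℕ} (h : Holds M m u lab c)

include h

theorem eval_edgesT : edgesT.eval M ρ = m := h.one

theorem eval_endsT : endsT.eval M ρ = 2 * m := by simp [endsT, eval_edgesT h]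

theorem eval_endT {j : Tm} (hj : j.eval M ρ < 2 * m) :
    (endT j).eval M ρ = u (j.eval M ρ) := h.ends _ hj

theorem eval_labelT {j : Tm} (hj : j.eval M ρ < 2 * m) :
    (labelT j).eval M ρ = lab (j.eval M ρ / 2) := by
  rw [← h.label _ (show j.eval M ρ / 2 < m by omega)]
  simp [labelT, Tm.eval, Op.eval, eval_endsT h]

theorem eval_targetT : targetT.eval M ρ = c := by
  rw [← h.target]
  simp [targetT, Tm.eval, eval_edgesT h]


theorem eval_adjT (h3 : ρ 3 < 2 * m) (h4 : ρ 4 < 2 * m) : adjT.eval M ρ = 0 ↔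
    ¬∃ k < m, (u (2 * k) = u (ρ 3) ∧ u (2 * k + 1) = u (ρ 4)) ∨
      (u (2 * k) = u (ρ 4) ∧ u (2 * k + 1) = u (ρ 3)) := by
  simp only [adjT, Tm.eval, eval_edgesT h, sum_eq_zero_iff, mem_range, not_exists, not_and]
  refine forall₂_congr fun k hk => ?_
  have e0 : (mulT (.const 2) (.var 5)).eval M (Function.update ρ 5 k) = 2 * k := by simp
  have e1 : (addT (mulT (.const 2) (.var 5)) (.const 1)).eval M (Function.update ρ 5 k) =
    2 * k + 1 := by simp
  have e3 : (Tm.var 3).eval M (Function.update ρ 5 k) = ρ 3 := by simp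
  have e4 : (Tm.var 4).eval M (Function.update ρ 5 k) = ρ 4 := by simp
  rw [eval_addT, eval_mulT, eval_mulT, eval_eqT, eval_eqT, eval_eqT, eval_eqT,
    eval_endT h (by rw [e0]; omega), eval_endT h (by rw [e3]; omega),
    eval_endT h (by rw [e1]; omega), eval_endT h (by rw [e4]; omega), e0, e1, e3, e4]
  by_cases h1 : u (2 * k) = u (ρ 3) <;> by_cases h2 : u (2 * k + 1) = u (ρ 4) <;>
    by_cases h3 : u (2 * k) = u (ρ 4) <;> by_cases h4 : u (2 * k + 1) = u (ρ 3) <;>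
    simp [h1, h2, h3, h4]

theorem eval_badT : badT.eval M ρ = 0 ↔ ∀ j < 2 * m, ∀ j' < 2 * m, lab (j / 2) = lab (j' / 2) →
    u j = u j' ∨ ∃ k < m, (u (2 * k) = u j ∧ u (2 * k + 1) = u j') ∨
      (u (2 * k) = u j' ∧ u (2 * k + 1) = u j) := by
  simp only [badT, Tm.eval, eval_endsT h, sum_eq_zero_iff, mem_range]
  refine forall₂_congr fun j hj => forall₂_congr fun j' hj' => ?_
  have e3 : Function.update (Function.update ρ 3 j) 4 j' 3 = j := by simp
  have e4 : Function.update (Function.update ρ 3 j) 4 j' 4 = j' := by simp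
  generalize Function.update (Function.update ρ 3 j) 4 j' = ρ' at e3 e4
  subst e3 e4
  rw [eval_mulT, eval_mulT, eval_eqT, eval_notT, eval_notT, eval_eqT, eval_labelT h (j := .var 3) hj,
    eval_labelT h (j := .var 4) hj', eval_endT h (j := .var 3) hj, eval_endT h (j := .var 4) hj']
  rw [if_congr (eval_adjT h hj hj') rfl rfl, eval_var, eval_var]
  by_cases h1 : lab (ρ' 3 / 2) = lab (ρ' 4 / 2) <;> by_cases h2 : u (ρ' 3) = u (ρ' 4) <;>
    by_cases h3 : ∃ k < m, (u (2 * k) = u (ρ' 3) ∧ u (2 * k + 1) = u (ρ' 4)) ∨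
      (u (2 * k) = u (ρ' 4) ∧ u (2 * k + 1) = u (ρ' 3)) <;>
    simp only [h1, h2, h3, if_true, if_false, not_true, not_false_eq_true, one_ne_zero] <;> simp

/-- The sum binds variable `4`; the scope condition keeps `p` constant under it. -/
theorem eval_dupT {p : Tm} (hp : p.Scoped 4) (hj : p.eval M ρ < 2 * m) :
    (dupT p).eval M ρ = 0 ↔ IsFirst u lab (p.eval M ρ) := by
  simp only [dupT, Tm.eval, sum_eq_zero_iff, mem_range, IsFirst]
  refine forall₂_congr fun j hjp => ?_
  have e : p.eval M (Function.update ρ 4 j) = p.eval M ρ :=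
    Tm.eval_congr M p hp fun r hr => Function.update_of_ne hr.ne _ _
  have e4 : (Tm.var 4).eval M (Function.update ρ 4 j) = j := by simp
  rw [eval_mulT, eval_eqT, eval_eqT, eval_labelT h (by rw [e4]; omega),
    eval_labelT h (by rw [e]; omega), eval_endT h (by rw [e4]; omega),
    eval_endT h (by rw [e]; omega), e, e4]
  simp only [mul_eq_zero, ite_eq_right_iff, one_ne_zero, imp_false]
  tauto

theorem eval_costT : costT.eval M ρ = labelCost m u lab := by
  rw [← card_filter_isFirst, card_filter]
  simp only [costT, Tm.eval, eval_endsT h]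
  refine sum_congr rfl fun j hj => ?_
  have e : (Tm.var 3).eval M (Function.update ρ 3 j) = j := by simp
  rw [eval_notT]
  refine if_congr ?_ rfl rfl
  rw [eval_dupT h (p := .var 3) (show (3 : ℕ) < 4 by norm_num) (by rw [e]; exact mem_range.1 hj), e]

theorem eval_invalidT : invalidT.eval M ρ = 0 ↔
    (∀ j < 2 * m, ∀ j' < 2 * m, lab (j / 2) = lab (j' / 2) →
      u j = u j' ∨ ∃ k < m, (u (2 * k) = u j ∧ u (2 * k + 1) = u j') ∨
      (u (2 * k) = u j' ∧ u (2 * k + 1) = u j)) ∧ labelCost m u lab = c := by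
  rw [invalidT, eval_addT, Nat.add_eq_zero_iff, eval_badT h, eval_notT, eval_eqT, eval_costT h,
    eval_targetT h]
  simp

theorem eval_usedT {i : Tm} (hi : i.Scoped 3) :
    (usedT i).eval M ρ = 0 ↔ ¬∃ j < 2 * m, lab (j / 2) = i.eval M ρ := by
  simp only [usedT, Tm.eval, eval_endsT h, sum_eq_zero_iff, mem_range, not_exists, not_and]
  refine forall₂_congr fun j hj => ?_
  have e : (Tm.var 3).eval M (Function.update ρ 3 j) = j := by simp
  rw [eval_eqT, eval_labelT h (by rw [e]; exact hj), e,
    Tm.eval_congr M i hi fun r hr => Function.update_of_ne hr.ne _ _]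
  simp

theorem eval_sizeT {i : Tm} (hi : i.Scoped 3) :
    (sizeT i).eval M ρ = (classPositions m u lab (i.eval M ρ)).length := by
  have hc : (classPositions m u lab (i.eval M ρ)).length = ((range (2 * m)).filter fun j =>
      lab (j / 2) = i.eval M ρ ∧ IsFirst u lab j).card := by
    rw [classPositions, ← List.toFinset_card_of_nodup (List.nodup_range.filter _)]
    congr 1
    ext j
    simp
  rw [hc, card_filter]
  simp only [sizeT, Tm.eval, eval_endsT h]
  refine sum_congr rfl fun j hj => ?_
  have e : (Tm.var 3).eval M (Function.update ρ 3 j) = j := by simp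
  rw [eval_mulT, eval_notT, eval_eqT, eval_labelT h (by rw [e]; exact mem_range.1 hj),
    Tm.eval_congr M i hi fun r hr => Function.update_of_ne hr.ne _ _]
  have hd := eval_dupT h (ρ := Function.update ρ 3 j) (p := .var 3)
    (show (3 : ℕ) < 4 by norm_num) (by rw [e]; exact mem_range.1 hj)
  rw [if_congr hd rfl rfl, e]
  split_ifs <;> simp_all

theorem eval_countT : countT.eval M ρ = (coverLists m u lab).length := by
  have hc : (coverLists m u lab).length = ((range m).filter fun i =>
      ∃ j < 2 * m, lab (j / 2) = i).card := by
    rw [coverLists, List.length_map, ← List.toFinset_card_of_nodup (List.nodup_range.filter _)]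
    congr 1
    ext j
    simp
  rw [hc, card_filter]
  simp only [countT, Tm.eval, eval_edgesT h]
  refine sum_congr rfl fun j hj => ?_
  have hu := eval_usedT h (ρ := Function.update ρ 2 j) (i := .var 2)
    (show (2 : ℕ) < 3 by norm_num)
  simp only [eval_var, Function.update_self] at hu
  rw [eval_notT, eval_notT, if_congr hu rfl rfl]
  split_ifs <;> simp_all

theorem eval_itemsT : itemsT.eval M ρ = 2 * m + 1 := by simp [itemsT, eval_endsT h]

theorem eval_itemLabelT : itemLabelT.eval M ρ = ρ 2 / (2 * m + 1) := by
  simp [itemLabelT, Tm.eval, Op.eval, eval_itemsT h]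

/-- Item number `i * (2 * m + 1) + r` belongs to label `i`: remainder `0` stands for the size of the
clique, remainder `j + 1` for the end in position `j`. -/
theorem eval_itemPosT : itemPosT.eval M ρ = ρ 2 % (2 * m + 1) := by
  have := Nat.div_add_mod' (ρ 2) (2 * m + 1)
  simp only [itemPosT, Tm.eval, Op.eval, eval_mulT, eval_itemLabelT h, eval_itemsT h]
  omega

theorem eval_itemEndT : itemEndT.eval M ρ = ρ 2 % (2 * m + 1) - 1 := by
  simp only [itemEndT, Tm.eval, Op.eval, eval_itemPosT h]

omit h in
theorem scoped_items : itemLabelT.Scoped 3 ∧ itemPosT.Scoped 3 ∧ itemEndT.Scoped 3 := by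
  simp [itemLabelT, itemPosT, itemEndT, itemsT, endsT, edgesT, mulT, addT, Tm.Scoped]

theorem eval_condT_size {i : ℕ} (hx : ρ 2 = i * (2 * m + 1)) :
    condT.eval M ρ ≠ 0 ↔ ∃ j < 2 * m, lab (j / 2) = i := by
  have e1 := eval_itemPosT h (ρ := ρ)
  have e2 := eval_itemLabelT h (ρ := ρ)
  have hu := eval_usedT h (ρ := ρ) scoped_items.1
  rw [hx, Nat.mul_mod_left] at e1
  rw [hx, Nat.mul_div_cancel _ (by omega)] at e2
  rw [e2] at hu
  rw [condT, eval_addT, eval_mulT, eval_mulT, eval_notT, eval_notT, eval_notT, e1]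
  simp [hu]

theorem eval_valT_size {i : ℕ} (hx : ρ 2 = i * (2 * m + 1)) :
    valT.eval M ρ = (classPositions m u lab i).length := by
  have e1 := eval_itemPosT h (ρ := ρ)
  have e2 := eval_itemLabelT h (ρ := ρ)
  have hu := eval_sizeT h (ρ := ρ) scoped_items.1
  rw [hx, Nat.mul_mod_left] at e1
  rw [hx, Nat.mul_div_cancel _ (by omega)] at e2
  rw [e2] at hu
  rw [valT, eval_addT, eval_mulT, eval_mulT, eval_notT, eval_notT, eval_notT, e1, hu]
  simp

omit h in
theorem item_div_mod {i j : ℕ} (hj : j < 2 * m) :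
    (i * (2 * m + 1) + (j + 1)) / (2 * m + 1) = i ∧
      (i * (2 * m + 1) + (j + 1)) % (2 * m + 1) = j + 1 := by
  constructor
  · rw [mul_comm, Nat.mul_add_div (by omega), Nat.div_eq_of_lt (by omega), add_zero]
  · rw [Nat.mul_add_mod', Nat.mod_eq_of_lt (by omega)]

theorem eval_condT_end {i j : ℕ} (hj : j < 2 * m) (hx : ρ 2 = i * (2 * m + 1) + (j + 1)) :
    condT.eval M ρ ≠ 0 ↔ lab (j / 2) = i ∧ IsFirst u lab j := by
  have e1 := eval_itemPosT h (ρ := ρ)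
  have e2 := eval_itemLabelT h (ρ := ρ)
  have e3 := eval_itemEndT h (ρ := ρ)
  rw [hx, (item_div_mod hj).2] at e1 e3
  rw [hx, (item_div_mod hj).1] at e2
  have hd := eval_dupT h (ρ := ρ) (p := itemEndT) (scoped_items.2.2.mono (by norm_num))
    (by rw [e3]; omega)
  rw [condT, eval_addT, eval_mulT, eval_mulT, eval_notT, eval_notT, eval_mulT, eval_eqT,
    eval_labelT h (by rw [e3]; omega), eval_notT, eval_notT, if_congr hd rfl rfl, e1, e2, e3]
  simp [and_comm]

theorem eval_valT_end {i j : ℕ} (hj : j < 2 * m) (hx : ρ 2 = i * (2 * m + 1) + (j + 1)) :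
    valT.eval M ρ = u j := by
  have e1 := eval_itemPosT h (ρ := ρ)
  have e3 := eval_itemEndT h (ρ := ρ)
  rw [hx, (item_div_mod hj).2] at e1 e3
  rw [valT, eval_addT, eval_mulT, eval_mulT, eval_notT, eval_notT, eval_notT,
    eval_endT h (by rw [e3]; omega), e1, e3]
  simp

end Eval

/-! ### Memory safety of the terms -/

section Safe

variable {S A : ℕ} {M ρ : ℕ → ℕ} {m : ℕ} {u lab : ℕ → ℕ} {c : ℕ}

theorem safe_eqT {a b : Tm} (ha : a.Safe S A M ρ) (hb : b.Safe S A M ρ) :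
    (eqT a b).Safe S A M ρ := ⟨trivial, ⟨ha, hb⟩, hb, ha⟩

theorem safe_notT {a : Tm} (ha : a.Safe S A M ρ) : (notT a).Safe S A M ρ := ⟨ha, trivial⟩

theorem safe_mulT {a b : Tm} (ha : a.Safe S A M ρ) (hb : b.Safe S A M ρ) :
    (mulT a b).Safe S A M ρ := ⟨ha, hb⟩

theorem safe_addT {a b : Tm} (ha : a.Safe S A M ρ) (hb : b.Safe S A M ρ) :
    (addT a b).Safe S A M ρ := ⟨ha, hb⟩

theorem safe_update {d x j : ℕ} {t : Tm} (ht : t.Scoped d) (hx : d ≤ x) (h : t.Safe S A M ρ) :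
    t.Safe S A M (Function.update ρ x j) :=
  Tm.safe_congr M t ht (fun _ hr => (Function.update_of_ne (by omega) _ _).symm) h

variable (h : Holds M m u lab c) (hS : 2 + 3 * m < S) (hA : 2 * m + 1 ≤ A)

include hS

theorem safe_edgesT : edgesT.Safe S A M ρ := ⟨trivial, by simp only [Tm.eval]; omega⟩

theorem safe_endsT : endsT.Safe S A M ρ := safe_mulT trivial (safe_edgesT hS)

include h

theorem safe_targetT : targetT.Safe S A M ρ :=
  ⟨safe_addT trivial (safe_mulT trivial (safe_edgesT hS)), by
    simp only [eval_addT, eval_mulT, eval_const, eval_edgesT h]; omega⟩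

omit h in
theorem safe_endT {j : Tm} (hs : j.Safe S A M ρ) (hj : j.eval M ρ < 2 * m) :
    (endT j).Safe S A M ρ :=
  ⟨safe_addT trivial hs, by simp only [eval_addT, eval_const]; omega⟩

theorem safe_labelT {j : Tm} (hs : j.Safe S A M ρ) (hj : j.eval M ρ < 2 * m) :
    (labelT j).Safe S A M ρ :=
  ⟨⟨⟨trivial, safe_endsT hS⟩, hs, trivial⟩, by
    simp only [eval_addT, Tm.eval, Op.eval, eval_endsT h]; omega⟩

include hA

theorem safe_adjT (h3 : ρ 3 < 2 * m) (h4 : ρ 4 < 2 * m) : adjT.Safe S A M ρ := by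
  refine ⟨safe_edgesT hS, by rw [eval_edgesT h]; omega, fun k hk => ?_⟩
  rw [eval_edgesT h] at hk
  have s3 : (endT (.var 3)).Safe S A M (Function.update ρ 5 k) :=
    safe_endT (m := m) hS (by simp [Tm.Safe]; omega) (by simpa using h3)
  have s4 : (endT (.var 4)).Safe S A M (Function.update ρ 5 k) :=
    safe_endT (m := m) hS (by simp [Tm.Safe]; omega) (by simpa using h4)
  have s0 : (endT (mulT (.const 2) (.var 5))).Safe S A M (Function.update ρ 5 k) :=
    safe_endT (m := m) hS (safe_mulT trivial (by simp [Tm.Safe]; omega)) (by simp; omega)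
  have s1 : (endT (addT (mulT (.const 2) (.var 5)) (.const 1))).Safe S A M
      (Function.update ρ 5 k) :=
    safe_endT (m := m) hS (safe_addT (safe_mulT trivial (by simp [Tm.Safe]; omega)) trivial)
      (by simp; omega)
  exact safe_addT (safe_mulT (safe_eqT s0 s3) (safe_eqT s1 s4))
    (safe_mulT (safe_eqT s0 s4) (safe_eqT s1 s3))

theorem safe_badT : badT.Safe S A M ρ := by
  refine ⟨safe_endsT hS, by rw [eval_endsT h]; omega, fun j hj => ?_⟩
  refine ⟨safe_endsT hS, by rw [eval_endsT h]; omega, fun j' hj' => ?_⟩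
  rw [eval_endsT h] at hj hj'
  have e3 : Function.update (Function.update ρ 3 j) 4 j' 3 < 2 * m := by simpa using hj
  have e4 : Function.update (Function.update ρ 3 j) 4 j' 4 < 2 * m := by simpa using hj'
  generalize Function.update (Function.update ρ 3 j) 4 j' = ρ' at e3 e4
  have s3 : (Tm.var 3).Safe S A M ρ' := by simp only [Tm.Safe]; omega
  have s4 : (Tm.var 4).Safe S A M ρ' := by simp only [Tm.Safe]; omega
  exact safe_mulT (safe_eqT (safe_labelT h hS s3 e3) (safe_labelT h hS s4 e4))
    (safe_mulT (safe_notT (safe_eqT (safe_endT hS s3 e3) (safe_endT hS s4 e4)))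
      (safe_notT (safe_adjT h hS hA e3 e4)))

theorem safe_dupT {p : Tm} (hp : p.Scoped 4) (hs : p.Safe S A M ρ) (hj : p.eval M ρ < 2 * m) :
    (dupT p).Safe S A M ρ := by
  refine ⟨hs, by omega, fun j hjp => ?_⟩
  have e : p.eval M (Function.update ρ 4 j) = p.eval M ρ :=
    Tm.eval_congr M p hp fun r hr => Function.update_of_ne hr.ne _ _
  have sp := safe_update (j := j) hp le_rfl hs
  have s4 : (Tm.var 4).Safe S A M (Function.update ρ 4 j) := by simp [Tm.Safe]; omega
  have e4 : (Tm.var 4).eval M (Function.update ρ 4 j) < 2 * m := by simp; omega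
  rw [← e] at hj
  exact safe_mulT (safe_eqT (safe_labelT h hS s4 e4) (safe_labelT h hS sp hj))
    (safe_eqT (safe_endT hS s4 e4) (safe_endT hS sp hj))

theorem safe_costT : costT.Safe S A M ρ := by
  refine ⟨safe_endsT hS, by rw [eval_endsT h]; omega, fun j hj => ?_⟩
  rw [eval_endsT h] at hj
  exact safe_notT (safe_dupT h hS hA (show (3 : ℕ) < 4 by norm_num)
    (by simp [Tm.Safe]; omega) (by simpa using hj))

theorem safe_invalidT : invalidT.Safe S A M ρ :=
  safe_addT (safe_badT h hS hA) (safe_notT (safe_eqT (safe_costT h hS hA) (safe_targetT h hS)))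

theorem safe_usedT {i : Tm} (hi : i.Scoped 3) (hs : i.Safe S A M ρ) :
    (usedT i).Safe S A M ρ := by
  refine ⟨safe_endsT hS, by rw [eval_endsT h]; omega, fun j hj => ?_⟩
  rw [eval_endsT h] at hj
  exact safe_eqT (safe_labelT h hS (by simp [Tm.Safe]; omega) (by simpa using hj))
    (safe_update hi le_rfl hs)

theorem safe_sizeT {i : Tm} (hi : i.Scoped 3) (hs : i.Safe S A M ρ) :
    (sizeT i).Safe S A M ρ := by
  refine ⟨safe_endsT hS, by rw [eval_endsT h]; omega, fun j hj => ?_⟩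
  rw [eval_endsT h] at hj
  have s3 : (Tm.var 3).Safe S A M (Function.update ρ 3 j) := by simp [Tm.Safe]; omega
  have e3 : (Tm.var 3).eval M (Function.update ρ 3 j) < 2 * m := by simpa using hj
  exact safe_mulT (safe_eqT (safe_labelT h hS s3 e3) (safe_update hi le_rfl hs))
    (safe_notT (safe_dupT h hS hA (show (3 : ℕ) < 4 by norm_num) s3 e3))

theorem safe_countT : countT.Safe S A M ρ := by
  refine ⟨safe_edgesT hS, by rw [eval_edgesT h]; omega, fun i hi => ?_⟩
  rw [eval_edgesT h] at hi
  exact safe_notT (safe_notT (safe_usedT h hS hA (show (2 : ℕ) < 3 by norm_num)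
    (by simp [Tm.Safe]; omega)))

omit h hA in
theorem safe_items (hx : ρ 2 ≤ A) : itemLabelT.Safe S A M ρ ∧ itemPosT.Safe S A M ρ ∧
    itemEndT.Safe S A M ρ := by
  have s : itemsT.Safe S A M ρ := safe_addT (safe_endsT hS) trivial
  have sl : itemLabelT.Safe S A M ρ := ⟨hx, s⟩
  have sp : itemPosT.Safe S A M ρ := ⟨hx, safe_mulT sl s⟩
  exact ⟨sl, sp, sp, trivial⟩

theorem safe_condT (hm : 0 < m) (hx : ρ 2 ≤ A) : condT.Safe S A M ρ := by
  obtain ⟨sl, sp, se⟩ := safe_items (M := M) hS hx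
  -- Terms have no branching, so the end is read even for a size item. Truncated subtraction then
  -- yields position `0`, which exists because `0 < m`.
  have he : itemEndT.eval M ρ < 2 * m := by
    rw [eval_itemEndT h]
    have := Nat.mod_lt (ρ 2) (show 2 * m + 1 > 0 by omega)
    omega
  exact safe_addT (safe_mulT (safe_notT sp) (safe_usedT h hS hA scoped_items.1 sl))
    (safe_mulT (safe_notT (safe_notT sp)) (safe_mulT (safe_eqT (safe_labelT h hS se he) sl)
      (safe_notT (safe_dupT h hS hA (scoped_items.2.2.mono (by norm_num)) se he))))

theorem safe_valT (hm : 0 < m) (hx : ρ 2 ≤ A) : valT.Safe S A M ρ := by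
  obtain ⟨sl, sp, se⟩ := safe_items (M := M) hS hx
  have he : itemEndT.eval M ρ < 2 * m := by
    rw [eval_itemEndT h]
    have := Nat.mod_lt (ρ 2) (show 2 * m + 1 > 0 by omega)
    omega
  exact safe_addT (safe_mulT (safe_notT sp) (safe_sizeT h hS hA scoped_items.1 sl))
    (safe_mulT (safe_notT (safe_notT sp)) (safe_endT hS se he))

end Safe

/-- Compiling at base `10` preserves the lower registers, where the program keeps its pointers and
counters. -/
theorem scoped_terms : invalidT.Scoped 10 ∧ countT.Scoped 10 ∧ condT.Scoped 10 ∧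
    valT.Scoped 10 := by
  simp [invalidT, badT, adjT, costT, targetT, countT, usedT, condT, valT, sizeT, dupT, itemEndT,
    itemPosT, itemLabelT, itemsT, endT, labelT, endsT, edgesT, eqT, notT, mulT, addT, Tm.Scoped]

end CliqueCover

/-! ### The program -/

namespace CliqueCover

open WordRAM

/-- The number of edges. -/
def edgesE : Expr := .load (.const 1)

/-- The address of the label of the edge in register `7`. -/
def labelE : Expr :=
  .op .add (.op .add (.const 2) (.op .mul (.const 2) edgesE)) (.reg 7)

/-- The address of the target. -/
def targetE : Expr := .op .add (.const 2) (.op .mul (.const 3) edgesE)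

/-- One step of the carry propagation. -/
def carryP : Prog :=
  .seq (.assign 8 (.op .add (.load labelE) (.reg 6)))
  (.seq (.store labelE (.op .sub (.reg 8) (.op .mul (.op .div (.reg 8) edgesE) edgesE)))
  (.seq (.assign 6 (.op .div (.reg 8) edgesE))
  (.assign 7 (.op .add (.reg 7) (.const 1)))))

/-- Passing to the next labeling, or to the next target after the last labeling. -/
def nextP : Prog :=
  .seq (.assign 6 (.const 1))
  (.seq (.assign 7 (.const 0))
  (.seq (.loop (.op .lt (.reg 7) edgesE) carryP)
  (.store targetE (.op .add (.load targetE) (.reg 6)))))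

/-- Searching for the first labeling that is proper and whose cost is the target. -/
def searchP : Prog :=
  .seq (invalidT.compile 10) (.loop (.reg 10) (.seq nextP (invalidT.compile 10)))

/-- Writing the output item with the number in register `2`. -/
def itemP : Prog :=
  .seq (condT.compile 10)
  (.seq (.ite (.reg 10)
    (.seq (valT.compile 10) (.seq (.store (.reg 1) (.reg 10))
      (.assign 1 (.op .add (.reg 1) (.const 1))))) .skip)
  (.assign 2 (.op .add (.reg 2) (.const 1))))

/-- Writing the output. -/
def outputP : Prog :=
  .seq (.assign 0 (.op .add targetE (.const 1)))
  (.seq (countT.compile 10)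
  (.seq (.store (.reg 0) (.reg 10))
  (.seq (.assign 1 (.op .add (.reg 0) (.const 1)))
  (.seq (.assign 2 (.const 0))
  (.loop (.op .lt (.reg 2) (.op .mul edgesE (.op .add (.op .mul (.const 2) edgesE) (.const 1))))
    itemP)))))

/-- The whole algorithm. -/
def coverP : Prog :=
  .seq (.assign 0 (.const 1)) (.ite edgesE (.seq searchP outputP) .skip)

theorem Holds.congr {M : ℕ → ℕ} {m c : ℕ} {u lab lab' : ℕ → ℕ} (h : Holds M m u lab c)
    (hl : ∀ e < m, lab e = lab' e) : Holds M m u lab' c :=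
  ⟨h.one, h.ends, fun e he => (h.label e he).trans (hl e he), h.target⟩

theorem Holds.setMem_out {σ : State} {m c : ℕ} {u lab : ℕ → ℕ} (h : Holds σ.mem m u lab c)
    {a x : ℕ} (ha : 3 + 3 * m ≤ a) : Holds (σ.setMem a x).mem m u lab c := by
  refine ⟨?_, fun j hj => ?_, fun e he => ?_, ?_⟩
  · rw [State.setMem_mem, if_neg (by omega), h.one]
  · rw [State.setMem_mem, if_neg (by omega), h.ends j hj]
  · rw [State.setMem_mem, if_neg (by omega), h.label e he]
  · rw [State.setMem_mem, if_neg (by omega), h.target]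

theorem Holds.setMem_label {σ : State} {m c : ℕ} {u lab : ℕ → ℕ} (h : Holds σ.mem m u lab c)
    {i x : ℕ} (hi : i < m) :
    Holds (σ.setMem (2 + 2 * m + i) x).mem m u (Function.update lab i x) c := by
  refine ⟨?_, fun j hj => ?_, fun e he => ?_, ?_⟩
  · rw [State.setMem_mem, if_neg (by omega), h.one]
  · rw [State.setMem_mem, if_neg (by omega), h.ends j hj]
  · rw [State.setMem_mem, Function.update_apply, h.label e he]
    exact if_congr (by omega) rfl rfl
  · rw [State.setMem_mem, if_neg (by omega), h.target]

theorem Holds.setMem_target {σ : State} {m c : ℕ} {u lab : ℕ → ℕ} (h : Holds σ.mem m u lab c)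
    {x : ℕ} : Holds (σ.setMem (2 + 3 * m) x).mem m u lab x := by
  refine ⟨?_, fun j hj => ?_, fun e he => ?_, ?_⟩
  · rw [State.setMem_mem, if_neg (by omega), h.one]
  · rw [State.setMem_mem, if_neg (by omega), h.ends j hj]
  · rw [State.setMem_mem, if_neg (by omega), h.label e he]
  · rw [State.setMem_mem, if_pos rfl]

/-- The largest exponent that the terms of the algorithm need. -/
def maxWt : ℕ := invalidT.wt + countT.wt + condT.wt + valT.wt

/-- The machine has enough cells and long enough words. -/
structure Fits (w S A m : ℕ) (u : ℕ → ℕ) : Prop where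
  pos : 0 < m
  le_bound : 16 ≤ A
  items : m * (2 * m + 1) ≤ A
  ends : ∀ j < 2 * m, u j ≤ A
  -- The input, labels and target fill `3 + 3 * m` cells; the output needs at most `3 * m + 1` more.
  cells : 6 * m + 4 ≤ S
  words : A ^ (maxWt + 2) < 2 ^ w

/-- All memory cells hold at most `A`. -/
def Bounded (S A : ℕ) (M : ℕ → ℕ) : Prop := ∀ a < S, M a ≤ A

theorem Bounded.setMem {S A a x : ℕ} {σ : State} (h : Bounded S A σ.mem) (hx : x ≤ A) :
    Bounded S A (σ.setMem a x).mem := by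
  intro b hb
  rw [State.setMem_mem]
  split_ifs
  exacts [hx, h b hb]

/-! ### Runs of the search -/

section Runs

variable {w S A m : ℕ} {u lab : ℕ → ℕ} {c : ℕ} (hf : Fits w S A m u)

include hf

theorem Fits.ends_le : 2 * m + 1 ≤ A :=
  le_trans (Nat.le_mul_of_pos_left _ hf.pos) hf.items

theorem Fits.word : 16 * A < 2 ^ w := by
  refine lt_of_le_of_lt ?_ hf.words
  have h1 := hf.le_bound
  calc 16 * A ≤ A ^ 2 := by nlinarith
    _ ≤ _ := Nat.pow_le_pow_right (by omega) (by omega)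

/-- Compiled terms compute their values. -/
theorem Fits.compile_runs {t : Tm} (ht : t.wt ≤ maxWt) (hs : t.Scoped 10) {σ : State}
    (hb : Bounded S A σ.mem) (hsafe : t.Safe S A σ.mem σ.reg) :
    Runs w S (t.compile 10) σ (A ^ maxWt) fun τ => τ.mem = σ.mem ∧
        τ.reg 10 = t.eval σ.mem σ.reg ∧ ∀ r < 10, τ.reg r = σ.reg r := by
  have h1 := hf.le_bound
  have h2 : A ^ t.wt ≤ A ^ maxWt := Nat.pow_le_pow_right (by omega) ht
  have h3 : A ^ maxWt ≤ A ^ (maxWt + 2) := Nat.pow_le_pow_right (by omega) (by omega)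
  exact (Tm.compile_runs h1 t 10 σ hb ((h2.trans h3).trans_lt hf.words) hs hsafe).le h2

/-- Before step `i` the digits below `i` are already those of `N + 1` and the others still those of
`N`. The carry is the difference of the quotients of `N + 1` and `N` by `m ^ i`. The target stays at
`N / m ^ m` until the final carry is added to it. -/
theorem carry_runs {N i : ℕ} (hi : i < m) {σ : State} (hb : Bounded S A σ.mem)
    (h : Holds σ.mem m u
      (fun e => if e < i then (N + 1) / m ^ e % m else N / m ^ e % m) (N / m ^ m))
    (h7 : σ.reg 7 = i) (h6 : (N + 1) / m ^ i = N / m ^ i + σ.reg 6) (h61 : σ.reg 6 ≤ 1) :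
    Runs w S carryP σ (12 + (18 + (5 + 4))) fun τ => Bounded S A τ.mem ∧
      Holds τ.mem m u
        (fun e => if e < i + 1 then (N + 1) / m ^ e % m else N / m ^ e % m) (N / m ^ m) ∧
      τ.reg 7 = i + 1 ∧ (N + 1) / m ^ (i + 1) = N / m ^ (i + 1) + τ.reg 6 ∧ τ.reg 6 ≤ 1 := by
  have hm := hf.pos
  have hc := hf.cells
  have hw := hf.word
  have hA := hf.ends_le
  have hA16 := hf.le_bound
  have hone := h.one
  have hlab := h.label i hi
  rw [if_neg (lt_irrefl i)] at hlab
  have hlt : N / m ^ i % m < m := Nat.mod_lt _ hm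
  generalize hs : N / m ^ i % m + σ.reg 6 = s
  have hsm : s ≤ m := by omega
  -- Dividing `N / m ^ i` plus the carry by `m` passes on exactly `s / m`, the next carry.
  have hdiv : N / m ^ (i + 1) + s / m = (N + 1) / m ^ (i + 1) := by
    rw [pow_succ, ← Nat.div_div_eq_div_mul, ← Nat.div_div_eq_div_mul, h6, ← hs]
    conv_rhs => rw [← Nat.div_add_mod (N / m ^ i) m, add_assoc, Nat.mul_add_div hm]
  have hmod : s - s / m * m = (N + 1) / m ^ i % m := by
    rw [h6, ← hs, Nat.mul_comm, ← Nat.mod_eq_sub_mul_div, Nat.mod_add_mod]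
  have hsle : s / m * m ≤ s := Nat.div_mul_le_self s m
  have hs1 : s / m ≤ 1 := by
    rw [← Nat.div_self hm]; exact Nat.div_le_div_right hsm
  refine Runs.seq (Runs.assign ?_ rfl) ?_
  · simp only [Expr.Legal, labelE, edgesE]
    generalize 2 ^ w = W at hw ⊢
    simp [Expr.eval, Op.eval, hone, h7, hlab]
    omega
  rintro _ rfl
  refine Runs.seq (Runs.store ?_ ?_ ?_ rfl) ?_
  · simp only [Expr.Legal, labelE, edgesE]
    generalize 2 ^ w = W at hw ⊢
    simp [Expr.eval, Op.eval, hone, h7]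
    omega
  · simp only [Expr.Legal, labelE, edgesE]
    generalize 2 ^ w = W at hw ⊢
    simp [Expr.eval, Op.eval, hone, h7, hlab, hs]
    omega
  · simp [Expr.eval, Op.eval, labelE, edgesE, hone, h7]
    omega
  rintro _ rfl
  have ha : labelE.eval (σ.setReg 8
      ((Expr.op .add (.load labelE) (.reg 6)).eval σ)) = 2 + 2 * m + i := by
    simp [Expr.eval, Op.eval, labelE, edgesE, hone, h7]
  have hv : (Expr.op .sub (.reg 8) (.op .mul (.op .div (.reg 8) edgesE) edgesE)).eval
      (σ.setReg 8 ((Expr.op .add (.load labelE) (.reg 6)).eval σ)) =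
      (N + 1) / m ^ i % m := by
    simp [Expr.eval, Op.eval, labelE, edgesE, hone, h7, hlab, hs, hmod]
  have hr8 : (σ.setReg 8 ((Expr.op .add (.load labelE) (.reg 6)).eval σ)).reg 8 = s := by
    simp [Expr.eval, Op.eval, labelE, edgesE, hone, h7, hlab, hs]
  have hr7 : (σ.setReg 8 ((Expr.op .add (.load labelE) (.reg 6)).eval σ)).reg 7 = i := by
    simp [h7]
  have hH : Holds (σ.setReg 8 ((Expr.op .add (.load labelE) (.reg 6)).eval σ)).mem m u _ _ := h
  have hB : Bounded S A (σ.setReg 8 ((Expr.op .add (.load labelE) (.reg 6)).eval σ)).mem := hb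
  rw [ha, hv]
  generalize σ.setReg 8 ((Expr.op .add (.load labelE) (.reg 6)).eval σ) = ρ at hr8 hr7 hH hB
  have hH' := (hH.setMem_label (x := (N + 1) / m ^ i % m) hi).congr
    (lab' := fun e => if e < i + 1 then (N + 1) / m ^ e % m else N / m ^ e % m) (by
      intro e he
      rw [Function.update_apply]
      rcases lt_trichotomy e i with h | h | h
      · rw [if_neg h.ne, if_pos h, if_pos (by omega)]
      · rw [if_pos h, if_pos (by omega), h]
      · rw [if_neg h.ne', if_neg (by omega), if_neg (by omega)])
  have hB' := hB.setMem (a := 2 + 2 * m + i) (x := (N + 1) / m ^ i % m)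
    (by have := Nat.mod_lt ((N + 1) / m ^ i) hm; omega)
  have hr8' : (ρ.setMem (2 + 2 * m + i) ((N + 1) / m ^ i % m)).reg 8 = s := hr8
  have hr7' : (ρ.setMem (2 + 2 * m + i) ((N + 1) / m ^ i % m)).reg 7 = i := hr7
  generalize ρ.setMem (2 + 2 * m + i) ((N + 1) / m ^ i % m) = ξ at hH' hB' hr8' hr7'
  have hone' := hH'.one
  refine Runs.seq (Runs.assign ?_ rfl) ?_
  · simp only [Expr.Legal, edgesE]
    generalize 2 ^ w = W at hw ⊢
    simp [Expr.eval, Op.eval, hone', hr8']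
    omega
  rintro _ rfl
  refine Runs.assign ?_ ⟨hB', hH', ?_, ?_, ?_⟩
  · simp only [Expr.Legal]
    generalize 2 ^ w = W at hw ⊢
    simp [Expr.eval, Op.eval, hr7']
    omega
  · simp [Expr.eval, Op.eval, hr7']
  · simp [Expr.eval, Op.eval, edgesE, hr8', hone', hdiv]
  · simp [Expr.eval, Op.eval, edgesE, hr8', hone', hs1]

/-- The memory for labeling number `N`. -/
def AtLabeling (S A m : ℕ) (u : ℕ → ℕ) (N : ℕ) (σ : State) : Prop :=
  Bounded S A σ.mem ∧ Holds σ.mem m u (fun e => N / m ^ e % m) (N / m ^ m)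

theorem next_runs {N : ℕ} (hN : (N + 1) / m ^ m ≤ A) {σ : State} (h : AtLabeling S A m u N σ) :
    Runs w S nextP σ (2 + (2 + ((m * (4 + 1 + 39) + (4 + 1)) + 16)))
      (AtLabeling S A m u (N + 1)) := by
  have hm := hf.pos
  have hc := hf.cells
  have hw := hf.word
  have hA := hf.ends_le
  have hA16 := hf.le_bound
  refine Runs.seq (Runs.assign (by simp only [Expr.Legal]; omega) rfl) ?_
  rintro _ rfl
  refine Runs.seq (Runs.assign (by simp only [Expr.Legal]; omega) rfl) ?_
  rintro _ rfl
  refine Runs.seq (Runs.loop (T := 39) (fun i τ => Bounded S A τ.mem ∧ Holds τ.mem m u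
    (fun e => if e < i then (N + 1) / m ^ e % m else N / m ^ e % m) (N / m ^ m) ∧
    τ.reg 7 = i ∧ (N + 1) / m ^ i = N / m ^ i + τ.reg 6 ∧ τ.reg 6 ≤ 1) m ?_ ?_ ?_) ?_
  · rintro i hi τ ⟨hb, hh, h7, h6, h61⟩
    refine ⟨?_, ?_, carry_runs hf hi hb hh h7 h6 h61⟩
    · simp only [Expr.Legal, edgesE]
      generalize 2 ^ w = W at hw ⊢
      simp [Expr.eval, Op.eval, hh.one, h7, hi]
      omega
    · simp [Expr.eval, Op.eval, edgesE, hh.one, h7, hi]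
  · rintro τ ⟨hb, hh, h7, h6, h61⟩
    refine ⟨?_, ?_⟩
    · simp only [Expr.Legal, edgesE]
      generalize 2 ^ w = W at hw ⊢
      simp [Expr.eval, Op.eval, hh.one, h7]
      omega
    · simp [Expr.eval, Op.eval, edgesE, hh.one, h7]
  · refine ⟨h.1, h.2.congr fun e _ => ?_, ?_, ?_, ?_⟩ <;> simp [Expr.eval]
  · rintro τ ⟨hb, hh, h7, h6, h61⟩
    have ha : targetE.eval τ = 2 + 3 * m := by
      simp [Expr.eval, Op.eval, targetE, edgesE, hh.one]
    have hv : (Expr.op .add (.load targetE) (.reg 6)).eval τ = (N + 1) / m ^ m := by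
      simp only [Expr.eval, Op.eval, ha, hh.target, h6]
    have hl : targetE.Legal w S τ := by
      simp only [Expr.Legal, targetE, edgesE]
      generalize 2 ^ w = W at hw ⊢
      simp [Expr.eval, Op.eval, hh.one]
      omega
    refine Runs.store hl ⟨⟨hl, by rw [ha]; omega⟩, trivial, ?_⟩ (by rw [ha]; omega) ?_
    · exact lt_of_le_of_lt (hv.le.trans hN) (by omega)
    · rw [ha, hv]
      exact ⟨hb.setMem hN, hh.setMem_target.congr fun e he => if_pos he⟩

/-- Labeling number `N` is proper and its cost is the target. -/
def IsGoal (m : ℕ) (u : ℕ → ℕ) (N : ℕ) : Prop :=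
  (∀ j < 2 * m, ∀ j' < 2 * m, N / m ^ (j / 2) % m = N / m ^ (j' / 2) % m →
    u j = u j' ∨ ∃ k < m, (u (2 * k) = u j ∧ u (2 * k + 1) = u j') ∨
      (u (2 * k) = u j' ∧ u (2 * k + 1) = u j)) ∧
  labelCost m u (fun e => N / m ^ e % m) = N / m ^ m

theorem test_runs {N : ℕ} {σ : State} (h : AtLabeling S A m u N σ) :
    Runs w S (invalidT.compile 10) σ (A ^ maxWt) fun τ =>
      AtLabeling S A m u N τ ∧ (τ.reg 10 = 0 ↔ IsGoal m u N) := by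
  have hc := hf.cells
  refine (hf.compile_runs (by unfold maxWt; omega) scoped_terms.1 h.1
    (safe_invalidT h.2 (by omega) hf.ends_le)).mono le_rfl ?_
  rintro τ ⟨hm, hr, -⟩
  refine ⟨⟨hm ▸ h.1, hm ▸ h.2⟩, ?_⟩
  rw [hr, eval_invalidT h.2, IsGoal]

theorem search_runs {N : ℕ} (hN : IsGoal m u N) (hmin : ∀ k < N, ¬IsGoal m u k) {σ : State}
    (h : AtLabeling S A m u 0 σ) :
    Runs w S searchP σ (A ^ maxWt + (N * (1 + 1 +
      ((2 + (2 + ((m * (4 + 1 + 39) + (4 + 1)) + 16))) + A ^ maxWt)) + (1 + 1)))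
      (AtLabeling S A m u N) := by
  have hA := hf.ends_le
  refine Runs.seq (test_runs hf h) fun τ hτ => ?_
  refine (Runs.loop (e := .reg 10) (fun k τ => AtLabeling S A m u k τ ∧
    (τ.reg 10 = 0 ↔ IsGoal m u k)) N ?_ ?_ hτ).mono le_rfl fun _ h => h.1
  · rintro k hk τ ⟨h1, h2⟩
    refine ⟨trivial, fun h => hmin k hk (h2.1 h), Runs.seq (next_runs hf ?_ h1)
      fun ρ hρ => test_runs hf hρ⟩
    -- Up to the first goal the target never exceeds the cost found there, so its cell stays within
    -- the bound `A`.
    calc (k + 1) / m ^ m ≤ N / m ^ m := Nat.div_le_div_right hk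
      _ = labelCost m u (fun e => N / m ^ e % m) := hN.2.symm
      _ ≤ 2 * m := labelCost_le
      _ ≤ A := by omega
  · rintro τ ⟨h1, h2⟩
    exact ⟨trivial, h2.2 hN⟩

end Runs

/-! ### The output -/

/-- The output item `x` is present. -/
def HasItem (m : ℕ) (u lab : ℕ → ℕ) (x : ℕ) : Prop :=
  if x % (2 * m + 1) = 0 then ∃ j < 2 * m, lab (j / 2) = x / (2 * m + 1)
  else lab ((x % (2 * m + 1) - 1) / 2) = x / (2 * m + 1) ∧
    IsFirst u lab (x % (2 * m + 1) - 1)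

instance (m : ℕ) (u lab : ℕ → ℕ) : DecidablePred (HasItem m u lab) := fun x => by
  unfold HasItem; infer_instance

/-- The value of the output item `x`. -/
def item (m : ℕ) (u lab : ℕ → ℕ) (x : ℕ) : ℕ :=
  if x % (2 * m + 1) = 0 then (classPositions m u lab (x / (2 * m + 1))).length
  else u (x % (2 * m + 1) - 1)

/-- The first output items. -/
def itemList (m : ℕ) (u lab : ℕ → ℕ) (N : ℕ) : List ℕ :=
  ((List.range N).filter fun x => HasItem m u lab x).map (item m u lab)

theorem itemList_succ (m : ℕ) (u lab : ℕ → ℕ) (N : ℕ) : itemList m u lab (N + 1) =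
    itemList m u lab N ++ if HasItem m u lab N then [item m u lab N] else [] := by
  simp only [itemList, List.range_succ, List.filter_append, List.map_append,
    List.filter_cons, List.filter_nil, decide_eq_true_eq]
  split_ifs <;> rfl

theorem length_itemList_mono {m : ℕ} {u lab : ℕ → ℕ} {N N' : ℕ} (h : N ≤ N') :
    (itemList m u lab N).length ≤ (itemList m u lab N').length := by
  simp only [itemList, List.length_map]
  exact ((List.range_sublist.2 h).filter _).length_le

/-- Cuts the range into `a` consecutive blocks of length `b`; applied with one block of item numbers
per label. -/
theorem filter_map_range_mul {α : Type*} (p : ℕ → Bool) (f : ℕ → α) (a b : ℕ) :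
    ((List.range (a * b)).filter p).map f = (List.range a).flatMap fun i =>
      ((List.range b).filter fun j => p (i * b + j)).map fun j => f (i * b + j) := by
  induction a with
  | zero => simp
  | succ a ih =>
    rw [Nat.succ_mul, List.range_add, List.filter_append, List.map_append, ih,
      List.range_succ, List.flatMap_append, List.filter_map, List.map_map]
    simp only [List.flatMap_cons, List.flatMap_nil, List.append_nil]
    rfl

theorem flatMap_filter_eq {α β : Type*} (p : α → Bool) (f : α → List β) (l : List α) :
    (l.filter p).flatMap f = l.flatMap fun x => if p x then f x else [] := by
  induction l with
  | nil => rfl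
  | cons a l ih => by_cases h : p a <;> simp [h, ih]

/-- In the block of a used label the number at offset `0` gives the size and the first occurrences
among the remaining `2 * m` numbers give the vertices. -/
theorem itemList_eq (m : ℕ) (u lab : ℕ → ℕ) : itemList m u lab (m * (2 * m + 1)) =
    (coverLists m u lab).flatMap fun l => l.length :: l := by
  rw [itemList, filter_map_range_mul, coverLists, List.flatMap_map, flatMap_filter_eq]
  refine List.flatMap_congr fun i _ => ?_
  have e0 : (decide (HasItem m u lab (i * (2 * m + 1) + 0))) =
      decide (∃ j < 2 * m, lab (j / 2) = i) := by
    simp [HasItem]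
  have e1 : item m u lab (i * (2 * m + 1) + 0) = (classPositions m u lab i).length := by
    simp [item]
  rw [List.range_succ_eq_map, List.filter_cons, e0, List.filter_map]
  have e2 : (List.range (2 * m)).filter ((fun j => decide (HasItem m u lab
      (i * (2 * m + 1) + j))) ∘ Nat.succ) = classPositions m u lab i := by
    refine List.filter_congr fun j hj => ?_
    have hj := List.mem_range.1 hj
    simp only [Function.comp_apply, HasItem, Nat.succ_eq_add_one, (item_div_mod hj).1,
      (item_div_mod hj).2, Nat.add_sub_cancel, if_neg (Nat.succ_ne_zero j)]
  have e3 : ((classPositions m u lab i).map Nat.succ).map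
      (fun j => item m u lab (i * (2 * m + 1) + j)) = (classPositions m u lab i).map u := by
    rw [List.map_map]
    refine List.map_congr_left fun j hj => ?_
    have hj := List.mem_range.1 (List.mem_filter.1 hj).1
    simp only [Function.comp_apply, item, Nat.succ_eq_add_one, (item_div_mod hj).2,
      Nat.add_sub_cancel, if_neg (Nat.succ_ne_zero j)]
  rw [e2]
  by_cases h : ∃ j < 2 * m, lab (j / 2) = i
  · simp only [h, decide_true, if_true, List.map_cons, e1, e3, List.length_map]
  -- An unused label has no positions either, so its whole block disappears.
  · have he : classPositions m u lab i = [] := by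
      refine List.filter_eq_nil_iff.2 fun j hj => ?_
      have hj := List.mem_range.1 hj
      simpa using fun h1 => absurd ⟨j, hj, h1⟩ h
    simp [h, he]

/-- The output words of a labeling. -/
def outputList (m : ℕ) (u lab : ℕ → ℕ) (N : ℕ) : List ℕ :=
  (coverLists m u lab).length :: itemList m u lab N

/-- At most `2 * m` vertex entries, `m` sizes and one count. Prefixes are included so that every
intermediate write is seen to stay inside the memory. -/
theorem length_outputList_le {m : ℕ} {u lab : ℕ → ℕ} (hlab : ∀ e < m, lab e < m) {N : ℕ}
    (hN : N ≤ m * (2 * m + 1)) : (outputList m u lab N).length ≤ 3 * m + 1 := by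
  have h1 := length_itemList_mono (m := m) (u := u) (lab := lab) hN
  have h2 : (itemList m u lab (m * (2 * m + 1))).length =
      ((coverLists m u lab).map List.length).sum + (coverLists m u lab).length := by
    rw [itemList_eq, List.length_flatMap]
    simp [List.sum_map_add]
  rw [sum_length_coverLists hlab] at h2
  have h3 : labelCost m u lab ≤ 2 * m := labelCost_le
  have h4 : (coverLists m u lab).length ≤ m := length_coverLists_le
  simp only [outputList, List.length_cons]
  omega

/-! ### Runs of the output phase -/

section Output

variable {w S A m : ℕ} {u lab : ℕ → ℕ} {c : ℕ} (hf : Fits w S A m u)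

theorem eval_condT {M ρ : ℕ → ℕ} (h : Holds M m u lab c) :
    condT.eval M ρ ≠ 0 ↔ HasItem m u lab (ρ 2) := by
  have hx := Nat.div_add_mod' (ρ 2) (2 * m + 1)
  have hlt := Nat.mod_lt (ρ 2) (show 2 * m + 1 > 0 by omega)
  rw [HasItem]
  split_ifs with h0
  · rw [eval_condT_size h (by rw [h0] at hx; exact hx.symm)]
  · rw [eval_condT_end h (i := ρ 2 / (2 * m + 1)) (j := ρ 2 % (2 * m + 1) - 1) (by omega)
      (by rw [Nat.sub_add_cancel (by omega)]; exact hx.symm)]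

theorem eval_valT {M ρ : ℕ → ℕ} (h : Holds M m u lab c) :
    valT.eval M ρ = item m u lab (ρ 2) := by
  have hx := Nat.div_add_mod' (ρ 2) (2 * m + 1)
  have hlt := Nat.mod_lt (ρ 2) (show 2 * m + 1 > 0 by omega)
  rw [item]
  split_ifs with h0
  · rw [eval_valT_size h (by rw [h0] at hx; exact hx.symm)]
  · rw [eval_valT_end h (i := ρ 2 / (2 * m + 1)) (j := ρ 2 % (2 * m + 1) - 1) (by omega)
      (by rw [Nat.sub_add_cancel (by omega)]; exact hx.symm)]

/-- The first output items have been written. -/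
structure Written (S A m : ℕ) (u lab : ℕ → ℕ) (c N : ℕ) (σ : State) : Prop where
  bounded : Bounded S A σ.mem
  holds : Holds σ.mem m u lab c
  start : σ.reg 0 = 3 + 3 * m
  pointer : σ.reg 1 = 3 + 3 * m + (outputList m u lab N).length
  counter : σ.reg 2 = N
  words : ∀ (i : ℕ) (hi : i < (outputList m u lab N).length),
    σ.mem (3 + 3 * m + i) = (outputList m u lab N)[i]

include hf

theorem item_le (x : ℕ) : item m u lab x ≤ A := by
  have hA := hf.ends_le
  have hm := hf.pos
  rw [item]
  split_ifs with h0
  · refine (List.length_filter_le _ _).trans ?_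
    rw [List.length_range]; omega
  · have := Nat.mod_lt x (show 2 * m + 1 > 0 by omega)
    exact hf.ends _ (by omega)

theorem item_runs (hlab : ∀ e < m, lab e < m) {N : ℕ} (hN : N < m * (2 * m + 1)) {σ : State}
    (h : Written S A m u lab c N σ) :
    Runs w S itemP σ (A ^ maxWt + ((1 + 1 + (A ^ maxWt + (3 + 4))) + 4))
      (Written S A m u lab c (N + 1)) := by
  have hm := hf.pos
  have hc := hf.cells
  have hw := hf.word
  have hA := hf.ends_le
  have hA16 := hf.le_bound
  have hNA : N < A := hN.trans_le hf.items
  have hlen := length_outputList_le (u := u) (N := N + 1) hlab hN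
  refine Runs.seq (hf.compile_runs (by unfold maxWt; omega) scoped_terms.2.2.1 h.bounded
    (safe_condT h.holds (by omega) hA hm (by rw [h.counter]; omega))) ?_
  rintro τ ⟨hmem, hr, hreg⟩
  rw [← hmem] at hr
  have hcond := eval_condT (ρ := σ.reg) h.holds
  rw [← hmem, ← hr, h.counter] at hcond
  have hW : Written S A m u lab c N τ := ⟨hmem ▸ h.bounded, hmem ▸ h.holds,
    (hreg 0 (by norm_num)).trans h.start, (hreg 1 (by norm_num)).trans h.pointer,
    (hreg 2 (by norm_num)).trans h.counter, by rw [hmem]; exact h.words⟩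
  clear hreg hr hmem h
  refine Runs.seq (R := fun ρ => Bounded S A ρ.mem ∧ Holds ρ.mem m u lab c ∧
    ρ.reg 0 = 3 + 3 * m ∧ ρ.reg 1 = 3 + 3 * m + (outputList m u lab (N + 1)).length ∧
    ρ.reg 2 = N ∧ ∀ (i : ℕ) (hi : i < (outputList m u lab (N + 1)).length),
      ρ.mem (3 + 3 * m + i) = (outputList m u lab (N + 1))[i]) ?_ ?_
  · by_cases hi : HasItem m u lab N
    · refine Runs.iteTrue trivial (hcond.2 hi) ?_
      have hout : outputList m u lab (N + 1) = outputList m u lab N ++ [item m u lab N] := by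
        simp [outputList, itemList_succ, hi]
      have hlen' : (outputList m u lab N).length + 1 ≤ 3 * m + 1 := by simpa [hout] using hlen
      refine Runs.seq (hf.compile_runs (by unfold maxWt; omega) scoped_terms.2.2.2 hW.bounded
        (safe_valT hW.holds (by omega) hA hm (by rw [hW.counter]; omega))) ?_
      rintro ρ ⟨hmem, hr, hreg⟩
      rw [eval_valT hW.holds, hW.counter] at hr
      have hp : ρ.reg 1 = 3 + 3 * m + (outputList m u lab N).length :=
        (hreg 1 (by norm_num)).trans hW.pointer
      refine Runs.seq (Runs.store trivial trivial ?_ rfl) ?_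
      · simp only [Expr.eval, hp]; omega
      rintro _ rfl
      simp only [Expr.eval, hp, hr]
      refine Runs.assign ?_ ⟨?_, ?_, ?_, ?_, ?_, ?_⟩
      · simp only [Expr.Legal]
        generalize 2 ^ w = W at hw ⊢
        simp [Expr.eval, Op.eval, hp]
        omega
      · exact Bounded.setMem (hmem ▸ hW.bounded) (item_le hf N)
      · exact Holds.setMem_out (hmem ▸ hW.holds) (by omega)
      · simp [hreg, hW.start]
      · simp [Expr.eval, Op.eval, hp, hout, add_assoc]
      · simp [hreg, hW.counter]
      · intro i hi
        rw [State.setReg_mem, State.setMem_mem]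
        simp only [hout, List.length_append, List.length_singleton] at hi ⊢
        split_ifs with he
        · obtain rfl : i = (outputList m u lab N).length := by omega
          simp
        · rw [List.getElem_append_left (by omega), hmem]
          exact hW.words i (by omega)
    · have hout : outputList m u lab (N + 1) = outputList m u lab N := by
        simp [outputList, itemList_succ, hi]
      refine Runs.le (Runs.iteFalse (e := .reg 10) trivial (not_not.1 (mt hcond.1 hi))
        (Runs.skip ?_)) ?_
      · rw [hout]
        exact ⟨hW.bounded, hW.holds, hW.start, hW.pointer, hW.counter, hW.words⟩
      · simp only [Expr.cost]; omega
  · rintro ρ ⟨h1, h2, h3, h4, h5, h6⟩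
    refine Runs.assign ?_ ⟨h1, h2, ?_, ?_, ?_, h6⟩
    · simp only [Expr.Legal]
      generalize 2 ^ w = W at hw ⊢
      simp [Expr.eval, Op.eval, h5]
      omega
    · simp [h3]
    · simp [h4]
    · simp [Expr.eval, Op.eval, h5]

theorem output_runs (hlab : ∀ e < m, lab e < m) {σ : State} (hb : Bounded S A σ.mem)
    (h : Holds σ.mem m u lab c) :
    Runs w S outputP σ (9 + (A ^ maxWt + (3 + (4 + (2 + (m * (2 * m + 1) *
      (11 + 1 + (A ^ maxWt + ((1 + 1 + (A ^ maxWt + (3 + 4))) + 4))) + (11 + 1)))))))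
      (Written S A m u lab c (m * (2 * m + 1))) := by
  have hm := hf.pos
  have hc := hf.cells
  have hw := hf.word
  have hA := hf.ends_le
  have hA16 := hf.le_bound
  have hit := hf.items
  have hlen : (coverLists m u lab).length ≤ m := length_coverLists_le
  have ha : (Expr.op .add targetE (.const 1)).eval σ = 3 + 3 * m := by
    simp [Expr.eval, Op.eval, targetE, edgesE, h.one]; omega
  refine Runs.seq (Runs.assign ?_ rfl) ?_
  · simp only [Expr.Legal, targetE, edgesE]
    generalize 2 ^ w = W at hw ⊢
    simp [Expr.eval, Op.eval, h.one]
    omega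
  rintro _ rfl
  rw [ha]
  refine Runs.seq (hf.compile_runs (by unfold maxWt; omega) scoped_terms.2.1 hb
    (safe_countT h (by omega) hA)) ?_
  rintro τ ⟨hmem, hr, hreg⟩
  have hmem : τ.mem = σ.mem := hmem
  rw [State.setReg_mem, eval_countT h] at hr
  have h0 : τ.reg 0 = 3 + 3 * m := (hreg 0 (by norm_num)).trans (by simp)
  refine Runs.seq (Runs.store trivial trivial ?_ rfl) ?_
  · simp only [Expr.eval, h0]; omega
  rintro _ rfl
  simp only [Expr.eval, h0, hr]
  refine Runs.seq (Runs.assign ?_ rfl) ?_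
  · simp only [Expr.Legal]
    generalize 2 ^ w = W at hw ⊢
    simp [Expr.eval, Op.eval, h0]
    omega
  rintro _ rfl
  refine Runs.seq (Runs.assign ?_ rfl) ?_
  · simp only [Expr.Legal]; omega
  rintro _ rfl
  refine Runs.loop (Written S A m u lab c) (m * (2 * m + 1)) ?_ ?_ ?_
  · intro k hk ρ hρ
    refine ⟨?_, ?_, item_runs hf hlab hk hρ⟩
    · simp only [Expr.Legal, edgesE]
      generalize 2 ^ w = W at hw ⊢
      simp [Expr.eval, Op.eval, hρ.holds.one, hρ.counter, hk]
      omega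
    · simp [Expr.eval, Op.eval, edgesE, hρ.holds.one, hρ.counter, hk]
  · intro ρ hρ
    refine ⟨?_, ?_⟩
    · simp only [Expr.Legal, edgesE]
      generalize 2 ^ w = W at hw ⊢
      simp [Expr.eval, Op.eval, hρ.holds.one, hρ.counter]
      omega
    · simp [Expr.eval, Op.eval, edgesE, hρ.holds.one, hρ.counter]
  · refine ⟨Bounded.setMem (hmem ▸ hb) (by omega), Holds.setMem_out (hmem ▸ h) le_rfl, ?_, ?_, ?_,
      ?_⟩
    · simp [h0]
    · simp [Expr.eval, Op.eval, h0, outputList, itemList]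
    · simp [Expr.eval]
    · intro i hi
      obtain rfl : i = 0 := by simpa [outputList, itemList] using hi
      simp [outputList]

end Output

end CliqueCover

/-! ### Correctness and running time -/

namespace CliqueCover

open WordRAM

/-! ### Replacing the vertices by their numbers -/

section Comp

variable {V W : Type*} [DecidableEq V] [DecidableEq W] {f : V → W} (hf : Function.Injective f)
  (m : ℕ) (v : ℕ → V) (lab : ℕ → ℕ)

include hf

theorem labelCost_comp : labelCost m (fun j => f (v j)) lab = labelCost m v lab := by
  rw [labelCost, labelCost, ← Finset.card_image_of_injective _ (Function.injective_id.prodMap hf),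
    Finset.image_image]
  rfl

theorem classPositions_comp (i : ℕ) :
    classPositions m (fun j => f (v j)) lab i = classPositions m v lab i := by
  refine List.filter_congr fun j _ => ?_
  rw [decide_eq_decide]
  simp only [IsFirst, hf.eq_iff]

theorem coverLists_comp :
    coverLists m (fun j => f (v j)) lab = (coverLists m v lab).map (List.map f) := by
  simp only [coverLists, classPositions_comp hf, List.map_map]
  refine List.map_congr_left fun i _ => ?_
  simp [Function.comp_def]

end Comp

theorem labelCost_congr {V : Type*} [DecidableEq V] {m : ℕ} {v : ℕ → V} {lab lab' : ℕ → ℕ}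
    (h : ∀ e < m, lab e = lab' e) : labelCost m v lab = labelCost m v lab' := by
  unfold labelCost
  congr 1
  refine Finset.image_congr fun j hj => ?_
  have hj := Finset.mem_range.1 (Finset.mem_coe.1 hj)
  simp only [h (j / 2) (by omega)]

/-- Every labeling has a number. -/
theorem exists_number {m : ℕ} (lab : ℕ → ℕ) (hlab : ∀ e < m, lab e < m) (c : ℕ) :
    ∃ N, (∀ e < m, N / m ^ e % m = lab e) ∧ N / m ^ m = c ∧ N < (c + 1) * m ^ m := by
  let g : Fin m → Fin m := fun e => ⟨lab e, hlab e e.2⟩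
  have hr : (finFunctionFinEquiv g : ℕ) < m ^ m := (finFunctionFinEquiv g).2
  have hd : ∀ e (he : e < m), (finFunctionFinEquiv g : ℕ) / m ^ e % m = lab e := by
    intro e he
    have := congrArg Fin.val (congrFun (finFunctionFinEquiv.symm_apply_apply g) ⟨e, he⟩)
    exact this
  generalize (finFunctionFinEquiv g : ℕ) = r at hr hd
  -- The number `r < m ^ m` has the labels as its base `m` digits; adding a multiple of `m ^ m`
  -- changes no digit below `m` and puts `c` into the quotient.
  refine ⟨m ^ m * c + r, fun e he => ?_, ?_, ?_⟩
  · have hm : 0 < m := by omega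
    have : m ^ m * c = m ^ e * (m * (m ^ (m - e - 1) * c)) := by
      rw [← mul_assoc, ← mul_assoc, ← pow_succ, ← pow_add]
      congr 2
      omega
    rw [this, Nat.mul_add_div (Nat.pow_pos hm), Nat.mul_add_mod, hd e he]
  · rw [Nat.mul_add_div (by omega), Nat.div_eq_of_lt hr, add_zero]
  · rw [Nat.succ_mul, mul_comm]; omega

/-! ### The first goal is optimal -/

section Goal

variable {n m : ℕ} {G : SimpleGraph (Fin n)} {v : ℕ → Fin n} (hG : HasEnds G m v)

include hG

theorem isGoal_iff (N : ℕ) : IsGoal m (fun j => (v j : ℕ)) N ↔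
    IsProper G m v (fun e => N / m ^ e % m) ∧
      labelCost m v (fun e => N / m ^ e % m) = N / m ^ m := by
  rw [IsGoal, labelCost_comp Fin.val_injective, IsProper]
  simp only [hG _ _, Fin.val_inj]

/-- The labeling is encoded with its own cost as target; the bound on the number follows from
`labelCost_le`. -/
theorem exists_isGoal {lab : ℕ → ℕ} (hlab : ∀ e < m, lab e < m) (h : IsProper G m v lab) :
    ∃ N, IsGoal m (fun j => (v j : ℕ)) N ∧ N / m ^ m = labelCost m v lab ∧
      N < (2 * m + 1) * m ^ m := by
  obtain ⟨N, h1, h2, h3⟩ := exists_number lab hlab (labelCost m v lab)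
  refine ⟨N, (isGoal_iff hG N).2 ⟨?_, ?_⟩, h2, h3.trans_le (Nat.mul_le_mul_right _ ?_)⟩
  · intro j hj j' hj' he
    have he : N / m ^ (j / 2) % m = N / m ^ (j' / 2) % m := he
    rw [h1 _ (by omega), h1 _ (by omega)] at he
    exact h j hj j' hj' he
  · rw [h2, labelCost_congr h1]
  · exact Nat.succ_le_succ labelCost_le

/-- The first labeling that passes the test gives an assignment-minimum clique cover. -/
theorem exists_first_goal (hm : 0 < m) : ∃ N, IsGoal m (fun j => (v j : ℕ)) N ∧
    (∀ k < N, ¬IsGoal m (fun j => (v j : ℕ)) k) ∧ N < (2 * m + 1) * m ^ m ∧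
    IsAssignmentMinimum G (labelCover m v fun e => N / m ^ e % m) ∧
    IsCoverList (labelCover m v fun e => N / m ^ e % m)
      (coverLists m v fun e => N / m ^ e % m) := by
  classical
  obtain ⟨N', hN', -, hlt⟩ := exists_isGoal hG (fun e he => he) (isProper_id hG)
  have hex : ∃ N, IsGoal m (fun j => (v j : ℕ)) N := ⟨N', hN'⟩
  obtain ⟨hp, hc⟩ := (isGoal_iff hG _).1 (Nat.find_spec hex)
  have hlab : ∀ e < m, Nat.find hex / m ^ e % m < m := fun e _ => Nat.mod_lt _ hm
  -- A competing proper labeling yields a goal whose target is its cost. The least goal is no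
  -- larger, and division by `m ^ m` preserves the order.
  obtain ⟨hmin, hinj⟩ := labelCover_isAssignmentMinimum hG hp (by
    intro lab' h1 h2
    obtain ⟨N'', g1, g2, -⟩ := exists_isGoal hG h1 h2
    rw [hc, ← g2]
    exact Nat.div_le_div_right (Nat.find_min' hex g1))
  refine ⟨Nat.find hex, Nat.find_spec hex, fun k hk => Nat.find_min hex hk,
    (Nat.find_min' hex hN').trans_lt hlt, hmin, ?_, ?_, ?_⟩
  · intro l hl
    obtain ⟨i, -, rfl⟩ := List.mem_map.1 hl
    exact nodup_classPositions_map i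
  · rw [coverLists_map_toFinset]
    refine List.Nodup.map_on (fun i hi j hj he => ?_) (List.nodup_range.filter _)
    rw [← List.mem_toFinset, usedLabels_toFinset hlab] at hi hj
    exact hinj hi hj he
  · rw [coverLists_map_toFinset, labelCover, ← usedLabels_toFinset hlab]
    ext C
    simp only [List.mem_toFinset, List.mem_map, Finset.mem_image]

end Goal

theorem encodeCover_coverLists {n m : ℕ} (v : ℕ → Fin n) (lab : ℕ → ℕ) :
    encodeCover (coverLists m v lab) =
      outputList m (fun j => (v j : ℕ)) lab (m * (2 * m + 1)) := by
  rw [outputList, itemList_eq, coverLists_comp Fin.val_injective, List.length_map,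
    List.flatMap_map, encodeCover]
  simp
  simp only [List.map_eq_flatMap]

/-! ### The input list of edges -/

section Input

variable {n : ℕ}

/-- The end of an edge in position `j` of the list. -/
def listEnd (es : List (Fin n × Fin n)) (d : Fin n × Fin n) (j : ℕ) : Fin n :=
  if j % 2 = 0 then (es.getD (j / 2) d).1 else (es.getD (j / 2) d).2

theorem getD_flatMap_ends (es : List (Fin n × Fin n)) (d : Fin n × Fin n) :
    ∀ j < 2 * es.length,
      (es.flatMap fun e => [(e.1 : ℕ), (e.2 : ℕ)]).getD j 0 = listEnd es d j := by
  induction es with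
  | nil => intro j hj; simp at hj
  | cons e es ih =>
    intro j hj
    match j with
    | 0 => simp [listEnd]
    | 1 => simp [listEnd]
    | j + 2 =>
      have h1 : (j + 2) / 2 = j / 2 + 1 := by omega
      have h2 : (j + 2) % 2 = j % 2 := by omega
      have := ih j (by simp at hj; omega)
      simpa [listEnd, h1, h2] using this

theorem length_flatMap_ends (es : List (Fin n × Fin n)) :
    (es.flatMap fun e => [(e.1 : ℕ), (e.2 : ℕ)]).length = 2 * es.length := by
  induction es with
  | nil => rfl
  | cons e es ih => simp [ih]; omega

variable {G : SimpleGraph (Fin n)} {es : List (Fin n × Fin n)} (h : IsEdgeList G es)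

include h

theorem IsEdgeList.length_eq : es.length = G.edgeSet.ncard := by
  have : G.edgeSet = ((es.map fun e => s(e.1, e.2)).toFinset : Set (Sym2 (Fin n))) := by
    ext e
    rw [Finset.mem_coe, List.mem_toFinset, h.2]
  rw [this, Set.ncard_coe_finset, List.toFinset_card_of_nodup h.1, List.length_map]

/-- This turns `m ^ m` into at most `n ^ (2 * m)`, the source of the logarithm of `n` in the
exponent. -/
theorem IsEdgeList.length_le : es.length ≤ n ^ 2 := by
  have := (List.Nodup.of_map _ h.1).length_le_card
  simpa [sq] using this

theorem IsEdgeList.hasEnds (d : Fin n × Fin n) : HasEnds G es.length (listEnd es d) := by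
  intro x y
  rw [← SimpleGraph.mem_edgeSet, ← h.2, List.mem_map]
  have h0 : ∀ k (hk : k < es.length), listEnd es d (2 * k) = es[k].1 := by
    intro k hk
    rw [listEnd, if_pos (by omega), show 2 * k / 2 = k by omega, List.getD_eq_getElem _ _ hk]
  have h1 : ∀ k (hk : k < es.length), listEnd es d (2 * k + 1) = es[k].2 := by
    intro k hk
    rw [listEnd, if_neg (by omega), show (2 * k + 1) / 2 = k by omega,
      List.getD_eq_getElem _ _ hk]
  constructor
  · rintro ⟨e, he, hxy⟩
    obtain ⟨k, hk, rfl⟩ := List.mem_iff_getElem.1 he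
    refine ⟨k, hk, ?_⟩
    rw [h0 k hk, h1 k hk]
    exact Sym2.eq_iff.1 hxy
  · rintro ⟨k, hk, hxy⟩
    rw [h0 k hk, h1 k hk] at hxy
    exact ⟨es[k], List.getElem_mem hk, Sym2.eq_iff.2 hxy⟩

/-- With `n ≥ 2`, constant factors can be absorbed into powers of `n`. -/
theorem IsEdgeList.two_le (hm : 0 < es.length) : 2 ≤ n := by
  have hadj : G.Adj es[0].1 es[0].2 := by
    rw [← SimpleGraph.mem_edgeSet, ← h.2]
    exact List.mem_map.2 ⟨es[0], List.getElem_mem hm, rfl⟩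
  by_contra hn
  have h1 := es[0].1.2
  have h2 := es[0].2.2
  exact hadj.ne (Fin.ext (by omega))

end Input

/-- The machine halts with the output of the first labeling that passes the test. -/
theorem coverP_runs {w S A n N : ℕ} {es : List (Fin n × Fin n)} {u : ℕ → ℕ}
    (hf : Fits w S A es.length u) (hn : n ≤ A)
    (hu : ∀ j < 2 * es.length, (es.flatMap fun e => [(e.1 : ℕ), (e.2 : ℕ)]).getD j 0 = u j)
    (hN : IsGoal es.length u N) (hmin : ∀ k < N, ¬IsGoal es.length u k)
    (hlt : N < (2 * es.length + 1) * es.length ^ es.length) :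
    Runs w S coverP (initState (encodeGraph es)) (A ^ (maxWt + 4) * es.length ^ es.length)
      (Written S A es.length u (fun e => N / es.length ^ e % es.length)
        (N / es.length ^ es.length) (es.length * (2 * es.length + 1))) := by
  have hlen := length_flatMap_ends es
  have hw := hf.word
  have hc := hf.cells
  have hA := hf.ends_le
  have hA16 := hf.le_bound
  have hm := hf.pos
  have hit := hf.items
  have hmem1 : (initState (encodeGraph es)).mem 1 = es.length := rfl
  have hmem2 : ∀ j, (initState (encodeGraph es)).mem (2 + j) =
      (es.flatMap fun e => [(e.1 : ℕ), (e.2 : ℕ)]).getD j 0 := by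
    intro j
    rw [add_comm]
    rfl
  have hzero : ∀ j, 2 * es.length ≤ j → (initState (encodeGraph es)).mem (2 + j) = 0 := by
    intro j hj
    rw [hmem2, List.getD_eq_default _ _ (by omega)]
  -- The cells after the input are `0`, which is already the encoding of labeling number `0` with
  -- target `0`; no initialization is needed.
  have hstart : AtLabeling S A es.length u 0 (initState (encodeGraph es)) := by
    refine ⟨?_, hmem1, fun j hj => (hmem2 j).trans (hu j hj), fun e he => ?_, ?_⟩
    · intro a _
      match a with
      | 0 => exact hn
      | 1 => rw [hmem1]; omega
      | a + 2 =>
        rw [add_comm]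
        by_cases ha : a < 2 * es.length
        · rw [hmem2, hu a ha]; exact hf.ends a ha
        · rw [hzero a (by omega)]; omega
    · rw [add_assoc, hzero _ (by omega), Nat.zero_div, Nat.zero_mod]
    · rw [hzero _ (by omega), Nat.zero_div]
  refine Runs.le (Runs.seq (U := 2 + 1 + ((A ^ maxWt + (N * (1 + 1 +
      ((2 + (2 + ((es.length * (4 + 1 + 39) + (4 + 1)) + 16))) + A ^ maxWt)) + (1 + 1))) +
      (9 + (A ^ maxWt + (3 + (4 + (2 + (es.length * (2 * es.length + 1) *
      (11 + 1 + (A ^ maxWt + ((1 + 1 + (A ^ maxWt + (3 + 4))) + 4))) + (11 + 1)))))))))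
    (Runs.assign (by simp only [Expr.Legal]; omega) rfl) ?_) ?_
  · rintro _ rfl
    refine Runs.iteTrue ?_ ?_ (Runs.seq (search_runs hf hN hmin hstart) fun τ hτ =>
      output_runs hf (fun e _ => Nat.mod_lt _ hm) hτ.1 hτ.2)
    · simp only [edgesE, Expr.Legal, Expr.eval]; omega
    · exact hm.ne'
  · have hX : 1 ≤ A ^ maxWt := Nat.one_le_pow _ _ (by omega)
    have hP : 1 ≤ es.length ^ es.length := Nat.one_le_pow _ _ hm
    rw [pow_add]
    generalize es.length ^ es.length = P at hP hlt ⊢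
    generalize A ^ maxWt = X at hX ⊢
    generalize hit' : es.length * (2 * es.length + 1) = I at hit ⊢
    -- There are at most `A * P` rounds of cost at most `60 * (A * X)`. The output loop and the
    -- remaining terms are also multiples of `A * P * (A * X)`, and the spare factor `A * A ≥ 256`
    -- covers the sum.
    have hNP : N ≤ A * P := hlt.le.trans (Nat.mul_le_mul_right _ hA)
    have h1 : N * (1 + 1 + ((2 + (2 + ((es.length * (4 + 1 + 39) + (4 + 1)) + 16))) + X)) ≤
        (A * P) * (60 * (A * X)) := by
      refine Nat.mul_le_mul hNP ?_
      have := Nat.mul_le_mul_left A hX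
      have := Nat.mul_le_mul_right X hA16
      omega
    have h2 : I * (11 + 1 + (X + ((1 + 1 + (X + (3 + 4))) + 4))) ≤ A * (27 * X) :=
      Nat.mul_le_mul hit (by omega)
    have h3 : A * (27 * X) ≤ (A * P) * (27 * (A * X)) :=
      Nat.mul_le_mul (Nat.le_mul_of_pos_right _ hP)
        (Nat.mul_le_mul_left _ (Nat.le_mul_of_pos_left _ (by omega)))
    have h4 : X ≤ A * P * (A * X) :=
      (Nat.le_mul_of_pos_left X (by omega : 0 < A)).trans
        (Nat.le_mul_of_pos_left _ (Nat.mul_pos (by omega) hP))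
    have h5 : X * A ^ 4 * P = A * P * (A * X) * (A * A) := by ring
    have h6 : A * P * (A * X) * (16 * 16) ≤ A * P * (A * X) * (A * A) :=
      Nat.mul_le_mul_left _ (Nat.mul_le_mul hA16 hA16)
    have h7 : (A * P) * (60 * (A * X)) = 60 * (A * P * (A * X)) := by ring
    have h8 : (A * P) * (27 * (A * X)) = 27 * (A * P * (A * X)) := by ring
    simp only [Expr.cost]
    omega

end CliqueCover

/-! ### The final bounds on time, space and word length -/

open CliqueCover WordRAM in
theorem corollary1 :
    ∃ (P : WordRAM.Prog) (K : ℕ), ∀ (n m : ℕ) (G : SimpleGraph (Fin n)),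
      G.edgeSet.ncard = m →
      ∀ es : List (Fin n × Fin n), CliqueCover.IsEdgeList G es →
        ∃ (𝒞 : Finset (Finset (Fin n))) (cs : List (List (Fin n))) (t : ℕ),
          CliqueCover.IsAssignmentMinimum G 𝒞 ∧
          CliqueCover.IsCoverList 𝒞 cs ∧
          WordRAM.Computes (K * (Nat.log 2 n + 1)) (K * (m * n + 1)) P
            (CliqueCover.encodeGraph es) t (CliqueCover.encodeCover cs) ∧
          (t : ℝ) ≤ (2 : ℝ) ^ ((K : ℝ) * ((m : ℝ) * Real.logb 2 (n : ℝ) + 1)) := by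
  -- The `8` comes from `16 * n ^ 4 ≤ n ^ 8`, the exponent `maxWt + 4` from the running time, and
  -- the `2` from `m ≤ n ^ 2`.
  refine ⟨coverP, 8 * (maxWt + 4) + 2, fun n m G hncard es hes => ?_⟩
  obtain rfl : es.length = m := hes.length_eq.trans hncard
  generalize hK : 8 * (maxWt + 4) + 2 = K
  have hnlog : n < 2 ^ (Nat.log 2 n + 1) := Nat.lt_pow_succ_log_self (by norm_num) n
  have hlen := length_flatMap_ends es
  have hxlen : (encodeGraph es).length = 2 + 2 * es.length := by
    rw [encodeGraph, List.length_cons, List.length_cons, hlen]; omega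
  rcases Nat.eq_zero_or_pos es.length with hm | hm
  -- Without edges the empty cover is optimal. The output address is `1`, where the input word `m =
  -- 0` serves as the number of cliques.
  · obtain rfl : es = [] := List.length_eq_zero_iff.1 hm
    have hnoadj : ∀ x y, ¬G.Adj x y := by
      intro x y hxy
      rw [← SimpleGraph.mem_edgeSet, ← hes.2] at hxy
      simp at hxy
    have hw2 : 2 ^ (Nat.log 2 n + 1) ≤ 2 ^ (K * (Nat.log 2 n + 1)) :=
      Nat.pow_le_pow_right (by norm_num) (Nat.le_mul_of_pos_left _ (by omega))
    have h2 : 2 ^ 1 ≤ 2 ^ (K * (Nat.log 2 n + 1)) :=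
      Nat.pow_le_pow_right (by norm_num) (Nat.mul_pos (by omega) (Nat.succ_pos _))
    refine ⟨∅, [], 2 + (2 + 1 + 1), ⟨⟨by simp, fun x y hxy => absurd hxy (hnoadj x y)⟩,
      fun 𝒟 _ => by simp [assignments]⟩, ⟨by simp, by simp, by simp⟩, ⟨?_, ?_, ?_⟩, ?_⟩
    · rw [hxlen]; simp; omega
    · intro x hx
      simp only [encodeGraph, List.flatMap_nil, List.length_nil, List.mem_cons,
        List.not_mem_nil, or_false] at hx
      rcases hx with rfl | rfl <;> omega
    · refine ⟨_, .seq (.assign _ 0 (.const 1) (by simp only [Expr.Legal]; omega))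
        (.iteFalse (e := edgesE) ?_ rfl (.skip _)), ?_, ?_⟩
      · simp only [edgesE, Expr.Legal, Expr.eval, List.length_nil, Nat.zero_mul]; omega
      · simp [encodeCover, Expr.eval]; omega
      · intro i hi
        obtain rfl : i = 0 := by simpa [encodeCover] using hi
        rfl
    · calc ((2 + (2 + 1 + 1) : ℕ) : ℝ) ≤ (2 : ℝ) ^ ((3 : ℕ) : ℝ) := by
            rw [Real.rpow_natCast]; norm_num
        _ ≤ _ := by
            refine Real.rpow_le_rpow_of_exponent_le (by norm_num) ?_
            have : (3 : ℝ) ≤ K := by exact_mod_cast (show 3 ≤ K by omega)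
            simpa using this
  · have hn2 := hes.two_le hm
    have hmn := hes.length_le
    have hv := hes.hasEnds es[0]
    obtain ⟨N, hN, hmin, hlt, hopt, hlist⟩ := exists_first_goal hv hm
    have h4 : 2 ^ 4 ≤ n ^ 4 := Nat.pow_le_pow_left hn2 4
    have hA8 : 16 * n ^ 4 ≤ n ^ 8 := by
      calc 16 * n ^ 4 ≤ n ^ 4 * n ^ 4 := Nat.mul_le_mul_right _ h4
        _ = n ^ 8 := by ring
    have hn1 : n ≤ n ^ 4 := Nat.le_self_pow (by norm_num) n
    -- The bound `16 * n ^ 4` exceeds `m * (2 * m + 1)`, which is at most `3 * n ^ 4`, and is at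
    -- least `16` as the compiler requires.
    have hf : Fits (K * (Nat.log 2 n + 1)) (K * (es.length * n + 1)) (16 * n ^ 4) es.length
        (fun j => (listEnd es es[0] j : ℕ)) := by
      refine ⟨hm, by omega, ?_, fun j _ => ?_, ?_, ?_⟩
      · have h1 : n ^ 4 = n ^ 2 * n ^ 2 := by ring
        have h2 : 1 ≤ n ^ 2 := Nat.one_le_pow _ _ (by omega)
        calc es.length * (2 * es.length + 1) ≤ n ^ 2 * (3 * n ^ 2) :=
              Nat.mul_le_mul hmn (by omega)
          _ ≤ 16 * n ^ 4 := by rw [h1]; nlinarith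
      · have := (listEnd es es[0] j).2
        omega
      · have h1 : es.length ≤ es.length * n := Nat.le_mul_of_pos_right _ (by omega)
        calc 6 * es.length + 4 ≤ 6 * (es.length * n + 1) := by omega
          _ ≤ K * (es.length * n + 1) := Nat.mul_le_mul_right _ (by omega)
      · calc (16 * n ^ 4) ^ (maxWt + 2) ≤ (n ^ 8) ^ (maxWt + 2) := Nat.pow_le_pow_left hA8 _
          _ = n ^ (8 * (maxWt + 2)) := by rw [pow_mul]
          _ < (2 ^ (Nat.log 2 n + 1)) ^ (8 * (maxWt + 2)) :=
            Nat.pow_lt_pow_left hnlog (by omega)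
          _ = 2 ^ (8 * (maxWt + 2) * (Nat.log 2 n + 1)) := by rw [← pow_mul, mul_comm]
          _ ≤ _ := Nat.pow_le_pow_right (by norm_num) (Nat.mul_le_mul_right _ (by omega))
    obtain ⟨t, τ, hexec, ht, hτ⟩ := coverP_runs hf (by omega)
      (getD_flatMap_ends es es[0]) hN hmin hlt
    have hw := hf.word
    have hcells := hf.cells
    have hends := hf.ends_le
    have houtlen := length_outputList_le (u := fun j => (listEnd es es[0] j : ℕ))
      (lab := fun e => N / es.length ^ e % es.length) (fun e _ => Nat.mod_lt _ hm) le_rfl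
    refine ⟨_, _, t, hopt, hlist, ⟨by omega, ?_, τ, hexec, ?_, ?_⟩, ?_⟩
    · intro x hx
      rw [encodeGraph, List.mem_cons, List.mem_cons, List.mem_flatMap] at hx
      rcases hx with rfl | rfl | ⟨e, -, hx⟩
      · omega
      · omega
      · have h1 := e.1.2
        have h2 := e.2.2
        simp only [List.mem_cons, List.not_mem_nil, or_false] at hx
        omega
    · rw [encodeCover_coverLists, hτ.start]
      omega
    · rw [encodeCover_coverLists, hτ.start]
      exact hτ.words
    -- Since `m ≥ 1`, the polynomial factor `n ^ (8 * (maxWt + 4))` is itself at most `n ^ (8 *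
    -- (maxWt + 4) * m)`.
    · have htn : t ≤ n ^ (K * es.length) := by
        calc t ≤ (16 * n ^ 4) ^ (maxWt + 4) * es.length ^ es.length := ht
          _ ≤ (n ^ 8) ^ (maxWt + 4) * (n ^ 2) ^ es.length :=
            Nat.mul_le_mul (Nat.pow_le_pow_left hA8 _) (Nat.pow_le_pow_left hmn _)
          _ = n ^ (8 * (maxWt + 4) + 2 * es.length) := by rw [← pow_mul, ← pow_mul, ← pow_add]
          _ ≤ n ^ (K * es.length) := by
            refine Nat.pow_le_pow_right (by omega) ?_
            rw [← hK, add_mul]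
            exact Nat.add_le_add_right (Nat.le_mul_of_pos_right _ hm) _
      have hnpos : (0 : ℝ) < n := by exact_mod_cast (show 0 < n by omega)
      calc (t : ℝ) ≤ ((n ^ (K * es.length) : ℕ) : ℝ) := by exact_mod_cast htn
        _ = ((2 : ℝ) ^ Real.logb 2 n) ^ ((K * es.length : ℕ) : ℝ) := by
          rw [Real.rpow_logb (by norm_num) (by norm_num) hnpos, Real.rpow_natCast, Nat.cast_pow]
        _ = (2 : ℝ) ^ (Real.logb 2 n * ((K * es.length : ℕ) : ℝ)) := by
          rw [← Real.rpow_mul (by norm_num)]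
        _ ≤ _ := by
          refine Real.rpow_le_rpow_of_exponent_le (by norm_num) ?_
          have hK0 : (0 : ℝ) ≤ K := Nat.cast_nonneg K
          push_cast
          nlinarith
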